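/- Consider Bernoulli site percolation on the triangular lattice with lattice spacing $\delta>0$ (adjacent sites are at distance $\delta$): each site is independently white with probability $p\in[0,1]$ and black otherwise, and the hexagon of the dual hexagonal lattice around the site gets the same colour. The edges between neighbouring hexagons of different colours are the interface edges, and a boundary path (or boundary loop, if it is closed) is a simple curve that is a concatenation of interface edges. Let $\mu_{\delta,p}$ be the law of the collection of all these interface curves. For $x\in\mathbb{R}^2$ and $r>0$ let $B(x;r)$ be the closed parallelogram of Euclidean side length $r$ centred at $x$ whose sides are parallel to two of the axes of the triangular lattice, let $B^\circ(x;r)$ be its interior, and let $A(x;r,R)=B(x;R)\setminus B^\circ(x;r)$. We say that $A(x;r,R)$ is crossed by $k$ disjoint curves if there are $k$ pairwise disjoint segments of boundary paths or loops (possibly of the same one), each of which stays in $A(x;r,R)$ and joins $\partial B(x;r)$ to $\partial B(x;R)$. Let $(\delta_j)_{j\in\mathbb{N}}$ be any sequence of positive numbers with $\delta_j\to 0$ and let $(p_j)_{j\in\mathbb{N}}$ be any sequence in $[0,1]$. Then there are constants $K_k<\infty$ and exponents $\phi(k)$, $k\in\mathbb{N}$, with $\phi(k)\to\infty$ as $k\to\infty$,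 such that for all $j$, all $k$, all $x\in\mathbb{R}^2$ and all $\delta_j\le r\le R\le 1$, $$\mu_{\delta_j,p_j}\bigl(A(x;r,R)\text{ is crossed by }k\text{ disjoint curves}\bigr)\le K_k\left(\frac{r}{R}\right)^{\phi(k)}.$$ -/

import Mathlib

open MeasureTheory Filter Topology

noncomputable section

namespace TriPerc

/-! ### The triangular lattice and its dual hexagonal lattice -/

/-- Sites of the triangular lattice, in lattice coordinates: `(a, b)` stands for
`a + b * e^{iπ/3}` times the lattice spacing. -/
abbrev Site := ℤ × ℤ

/-- The lattice direction `e^{iπ/3}`. -/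
def axis : ℂ := ⟨1 / 2, √3 / 2⟩

/-- Position in the plane of a site of the triangular lattice with lattice spacing `δ`. -/
def pos (δ : ℝ) (v : Site) : ℂ := (δ : ℂ) * ((v.1 : ℂ) + (v.2 : ℂ) * axis)

/-- Adjacency in the triangular lattice: each site has six neighbours. -/
def Adj (v w : Site) : Prop :=
  w - v ∈ ({(1, 0), (-1, 0), (0, 1), (0, -1), (1, -1), (-1, 1)} : Set Site)

/-- For adjacent sites `v`, `w`: the edge of the hexagonal lattice shared by the hexagonal faces
around `v` and `w`. It is the closed segment of length `δ / √3` which is perpendicular to the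
segment from `v` to `w` and has the same midpoint. -/
def hexEdge (δ : ℝ) (v w : Site) : Set ℂ :=
  segment ℝ
    ((pos δ v + pos δ w) / 2 - Complex.I * (pos δ w - pos δ v) / (2 * (√3 : ℂ)))
    ((pos δ v + pos δ w) / 2 + Complex.I * (pos δ w - pos δ v) / (2 * (√3 : ℂ)))

/-! ### Percolation and its interfaces -/

/-- A colouring of the sites (hexagons): `true` is white, `false` is black. -/
abbrev Config := Site → Bool

/-- Bernoulli site percolation: the sites are independently white with probability `p` and
black with probability `1 - p`. -/
def percolation (p : unitInterval) : Measure Config :=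
  Measure.infinitePi fun _ : Site => ProbabilityTheory.bernoulliMeasure true false p

/-- Parametrized continuous curves in the plane. -/
abbrev Curve := C(unitInterval, ℂ)

/-- The collection of all interface curves (boundary paths and boundary loops) of a
configuration on the lattice with spacing `δ`: simple curves, open or closed, which are formed
by concatenating edges between neighbouring hexagons of different colours. -/
def boundaryCurves (δ : ℝ) (ω : Config) : Set Curve :=
  {γ | (∃ S : Set (Site × Site),
          (∀ e ∈ S, Adj e.1 e.2 ∧ ω e.1 ≠ ω e.2) ∧
          Set.range γ = ⋃ e ∈ S, hexEdge δ e.1 e.2) ∧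
       ∀ s t, γ s = γ t → s = t ∨ (s = 0 ∧ t = 1) ∨ (s = 1 ∧ t = 0)}

/-- The law `μ_{δ,p}` of the collection of all interface curves, as a function of events
(sets of collections of curves). -/
def interfaceLaw (δ : ℝ) (p : unitInterval) (E : Set (Set Curve)) : ENNReal :=
  percolation p {ω | boundaryCurves δ ω ∈ E}

/-! ### Annuli and crossings -/

/-- The box `B(x; r)`: the closed parallelogram with side length `r`, centred at `x`, with sides
parallel to two of the axes of the triangular lattice. -/
def box (x : ℂ) (r : ℝ) : Set ℂ :=
  {z | ∃ s t : ℝ, |s| ≤ r / 2 ∧ |t| ≤ r / 2 ∧ z = x + s + t * axis}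

/-- The annulus `A(x; r, R) = B(x; R) \ B°(x; r)`. -/
def annulus (x : ℂ) (r R : ℝ) : Set ℂ := box x R \ interior (box x r)

/-- The segment of the curve `γ` between the times `s` and `t` crosses `A(x; r, R)`: it stays in
the annulus and joins the inner boundary to the outer boundary. -/
def SegmentCrosses (x : ℂ) (r R : ℝ) (γ : Curve) (s t : unitInterval) : Prop :=
  γ s ∈ frontier (box x r) ∧ γ t ∈ frontier (box x R) ∧ γ '' Set.uIcc s t ⊆ annulus x r R

/-- The event, for a collection `F` of curves, that `A(x; r, R)` is crossed by `k` pairwise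
disjoint curves, that is, by `k` pairwise disjoint segments of curves of the collection. (Different
segments may belong to the same curve.) -/
def CrossedBy (x : ℂ) (r R : ℝ) (k : ℕ) : Set (Set Curve) :=
  {F | ∃ (γ : Fin k → Curve) (s t : Fin k → unitInterval),
      (∀ i, γ i ∈ F ∧ SegmentCrosses x r R (γ i) (s i) (t i)) ∧
      ∀ i j, i ≠ j → Disjoint (γ i '' Set.uIcc (s i) (t i)) (γ j '' Set.uIcc (s j) (t j))}

end TriPerc

end

noncomputable section

namespace TriPerc

/-! ### Random subsets of a finite set -/

section Cube

variable {α : Type*}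

/-! Along an interface segment the sites of either colour adjacent to it form a connected set
(`linked_trail`). Let `c` be a colour of probability at most 1/2. Then `k` disjoint interface
crossings give `k` crossings in colour `c`, and one site is used by at most 81 of them
(`card_trail_le`). Having many crossings in colour `c` is an increasing event, so its probability is
largest at density 1/2 (`Increasing.bern_le_unif`); this is why the bound is uniform in `p`.

At density 1/2 there is a Russo–Seymour–Welsh estimate. The Hex theorem and the symmetries of the
rhombus give a crossing of probability at least 1/2, and `sq_vProb_div_four_le` doubles the length
of a crossed rectangle at the price of replacing its probability `P` by `P ^ 2 / 4`. Hence a long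
rectangle is crossed lengthwise with probability at least `2 ^ (-46)`. Such a crossing in the other
colour blocks all short crossings, so these have probability at most `1 - 2 ^ (-46)`
(`unif_hCross_le`).

A path from near the centre to far away crosses, at each scale `4 ^ i`, one of the three sides of a
triangular annulus, each side being such a rectangle (`exists_sideCross`). Among many crossings of
one rectangle with bounded multiplicity there are proportionally many disjoint ones
(`exists_disjoint_hCross`, a planar form of Menger's theorem): with 3 sides and multiplicity 81, `k
/ 243` of them. The van den Berg–Kesten inequality bounds one scale by `3 * (1 - 2 ^ (-46)) ^ (k /
243)`, and applied once more it multiplies these bounds over the scales. There are about `log (R /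
r)` scales, which gives a power of `r / R`; its exponent tends to infinity because the factor per
scale tends to zero. -/

/-- Increasing events. -/
def Increasing (A : Finset α → Prop) : Prop := ∀ S T, S ⊆ T → A S → A T

/-- Disjoint occurrence of two increasing events. -/
def DisjOcc (A B : Finset α → Prop) (S : Finset α) : Prop :=
  ∃ T₁ T₂, T₁ ⊆ S ∧ T₂ ⊆ S ∧ Disjoint T₁ T₂ ∧ A T₁ ∧ B T₂

lemma increasing_disjOcc (A B : Finset α → Prop) : Increasing (DisjOcc A B) := by
  rintro S T h ⟨T₁, T₂, h1, h2, h3⟩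
  exact ⟨T₁, T₂, h1.trans h, h2.trans h, h3⟩

lemma DisjOcc.mono {A B A' B' : Finset α → Prop} (hA : ∀ S, A S → A' S) (hB : ∀ S, B S → B' S)
    {S : Finset α} : DisjOcc A B S → DisjOcc A' B' S := by
  rintro ⟨T₁, T₂, h1, h2, h3, h4, h5⟩
  exact ⟨T₁, T₂, h1, h2, h3, hA _ h4, hB _ h5⟩

/-- Disjoint occurrence of the first `n` of a sequence of increasing events. -/
def DisjOccs (A : ℕ → Finset α → Prop) : ℕ → Finset α → Prop
  | 0 => fun _ => True
  | n + 1 => DisjOcc (DisjOccs A n) (A n)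

lemma increasing_disjOccs (A : ℕ → Finset α → Prop) (n : ℕ) : Increasing (DisjOccs A n) := by
  cases n with
  | zero => exact fun _ _ _ h => h
  | succ n => exact increasing_disjOcc _ _

variable [DecidableEq α]

open Classical in
/-- The probability that the random subset of `Λ`, which contains each element independently with
probability `q`, has the property `A`. -/
def bern (q : ℝ) (Λ : Finset α) (A : Finset α → Prop) : ℝ :=
  ∑ S ∈ Λ.powerset, if A S then q ^ S.card * (1 - q) ^ (Λ \ S).card else 0

/-- The probability of a property of a uniformly chosen subset of `Λ`. -/
abbrev unif (Λ : Finset α) (A : Finset α → Prop) : ℝ := bern (1 / 2) Λ A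

lemma bern_empty (q : ℝ) (A : Finset α → Prop) [Decidable (A ∅)] :
    bern q ∅ A = if A ∅ then 1 else 0 := by
  simp [bern]

lemma bern_insert (q : ℝ) {Λ : Finset α} {a : α} (ha : a ∉ Λ) (A : Finset α → Prop) :
    bern q (insert a Λ) A =
      (1 - q) * bern q Λ A + q * bern q Λ (fun S => A (insert a S)) := by
  classical
  unfold bern
  rw [Finset.sum_powerset_insert ha, Finset.mul_sum, Finset.mul_sum]
  congr 1
  · refine Finset.sum_congr rfl fun S hS => ?_
    have hS' := Finset.mem_powerset.1 hS
    have haS : a ∉ S := fun h => ha (hS' h)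
    rw [Finset.insert_sdiff_of_notMem _ haS,
      Finset.card_insert_of_notMem (fun h => ha (Finset.mem_sdiff.1 h).1)]
    split_ifs <;> ring
  · refine Finset.sum_congr rfl fun S hS => ?_
    have hS' := Finset.mem_powerset.1 hS
    have haS : a ∉ S := fun h => ha (hS' h)
    have : insert a Λ \ insert a S = Λ \ S := by
      ext z
      simp only [Finset.mem_sdiff, Finset.mem_insert]
      constructor
      · rintro ⟨h1, h2⟩; tauto
      · rintro ⟨h1, h2⟩
        refine ⟨Or.inr h1, ?_⟩
        rintro (rfl | h)
        exacts [ha h1, h2 h]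
    rw [this, Finset.card_insert_of_notMem haS]
    split_ifs <;> ring

lemma unif_insert {Λ : Finset α} {a : α} (ha : a ∉ Λ) (A : Finset α → Prop) :
    unif (insert a Λ) A = (unif Λ A + unif Λ (fun S => A (insert a S))) / 2 := by
  rw [unif, bern_insert _ ha]; ring

lemma bern_nonneg {q : ℝ} (h0 : 0 ≤ q) (h1 : q ≤ 1) (Λ : Finset α) (A : Finset α → Prop) :
    0 ≤ bern q Λ A := by
  classical
  refine Finset.sum_nonneg fun S _ => ?_
  have : 0 ≤ 1 - q := by linarith
  split_ifs <;> positivity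

lemma unif_nonneg (Λ : Finset α) (A : Finset α → Prop) : 0 ≤ unif Λ A :=
  bern_nonneg (by norm_num) (by norm_num) Λ A

lemma bern_mono {q : ℝ} (h0 : 0 ≤ q) (h1 : q ≤ 1) {Λ : Finset α} {A B : Finset α → Prop}
    (h : ∀ S ⊆ Λ, A S → B S) : bern q Λ A ≤ bern q Λ B := by
  classical
  refine Finset.sum_le_sum fun S hS => ?_
  have : 0 ≤ 1 - q := by linarith
  by_cases hA : A S
  · simp [hA, h S (Finset.mem_powerset.1 hS) hA]
  · simp only [hA, if_false]
    split_ifs <;> positivity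

lemma unif_mono {Λ : Finset α} {A B : Finset α → Prop} (h : ∀ S ⊆ Λ, A S → B S) :
    unif Λ A ≤ unif Λ B :=
  bern_mono (by norm_num) (by norm_num) h

lemma unif_congr {Λ : Finset α} {A B : Finset α → Prop} (h : ∀ S ⊆ Λ, A S ↔ B S) :
    unif Λ A = unif Λ B :=
  le_antisymm (unif_mono fun S hS => (h S hS).1) (unif_mono fun S hS => (h S hS).2)

lemma unif_or_add_and (Λ : Finset α) (A B : Finset α → Prop) :
    unif Λ (fun S => A S ∨ B S) + unif Λ (fun S => A S ∧ B S) = unif Λ A + unif Λ B := by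
  classical
  simp only [unif, bern, ← Finset.sum_add_distrib]
  refine Finset.sum_congr rfl fun S _ => ?_
  by_cases hA : A S <;> by_cases hB : B S <;> simp [hA, hB]

lemma unif_or_le (Λ : Finset α) (A B : Finset α → Prop) :
    unif Λ (fun S => A S ∨ B S) ≤ unif Λ A + unif Λ B := by
  have := unif_or_add_and Λ A B
  have := unif_nonneg Λ (fun S => A S ∧ B S)
  linarith

open Classical in
lemma unif_eq_card (Λ : Finset α) (A : Finset α → Prop) :
    unif Λ A = (Λ.powerset.filter A).card / 2 ^ Λ.card := by
  rw [unif, bern, Finset.card_filter, Nat.cast_sum, Finset.sum_div]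
  refine Finset.sum_congr rfl fun S hS => ?_
  have h := Finset.card_sdiff_add_card_eq_card (Finset.mem_powerset.1 hS)
  split_ifs with hA
  · have : (1 - 1 / 2 : ℝ) = 1 / 2 := by norm_num
    rw [this, ← pow_add, ← h, add_comm]
    simp
  · simp

lemma unif_true (Λ : Finset α) : unif Λ (fun _ => True) = 1 := by
  rw [unif_eq_card]; simp

lemma unif_not (Λ : Finset α) (A : Finset α → Prop) :
    unif Λ (fun S => ¬ A S) = 1 - unif Λ A := by
  have h := unif_or_add_and Λ A (fun S => ¬ A S)
  have h1 : unif Λ (fun S => A S ∨ ¬ A S) = 1 := by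
    rw [← unif_true Λ]; exact unif_congr fun S _ => by simp [em]
  have h2 : unif Λ (fun S => A S ∧ ¬ A S) = 0 := by simp [unif, bern]
  linarith

/-- A self-map of the configurations which is injective on `A` and sends `A` into `B`
shows that `B` is at least as likely as `A`. -/
lemma unif_le_of_injOn {Λ : Finset α} {A B : Finset α → Prop} (f : Finset α → Finset α)
    (hf : ∀ S ⊆ Λ, A S → f S ⊆ Λ ∧ B (f S))
    (hinj : ∀ S ⊆ Λ, ∀ T ⊆ Λ, A S → A T → f S = f T → S = T) :
    unif Λ A ≤ unif Λ B := by
  classical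
  rw [unif_eq_card, unif_eq_card]
  refine div_le_div_of_nonneg_right (Nat.cast_le.2 ?_) (by positivity)
  refine Finset.card_le_card_of_injOn f ?_ ?_
  · intro S hS
    simp only [Finset.coe_filter, Finset.mem_powerset, Set.mem_ofPred_eq] at hS ⊢
    exact hf S hS.1 hS.2
  · intro S hS T hT h
    simp only [Finset.coe_filter, Finset.mem_powerset, Set.mem_ofPred_eq] at hS hT
    exact hinj S hS.1 T hT.1 hS.2 hT.2 h

lemma unif_compl (Λ : Finset α) (A : Finset α → Prop) :
    unif Λ (fun S => A (Λ \ S)) = unif Λ A := by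
  apply le_antisymm
  · refine unif_le_of_injOn (fun S => Λ \ S) (fun S _ h => ⟨Finset.sdiff_subset, h⟩) ?_
    intro S hS T hT _ _ h
    rw [← Finset.sdiff_sdiff_eq_self hS, ← Finset.sdiff_sdiff_eq_self hT]
    exact congrArg (Λ \ ·) h
  · refine unif_le_of_injOn (fun S => Λ \ S) (fun S hS h => ⟨Finset.sdiff_subset, ?_⟩) ?_
    · rwa [Finset.sdiff_sdiff_eq_self hS]
    intro S hS T hT _ _ h
    rw [← Finset.sdiff_sdiff_eq_self hS, ← Finset.sdiff_sdiff_eq_self hT]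
    exact congrArg (Λ \ ·) h

lemma unif_map {β : Type*} [DecidableEq β] (e : α ≃ β) (Λ : Finset α) (A : Finset β → Prop) :
    unif (Λ.map e.toEmbedding) A = unif Λ (fun S => A (S.map e.toEmbedding)) := by
  induction Λ using Finset.induction_on generalizing A with
  | empty => simp only [unif, bern, Finset.map_empty, Finset.powerset_empty, Finset.sum_singleton]; congr
  | insert a Λ ha ih =>
    rw [Finset.map_insert, unif_insert (by simpa using ha), unif_insert ha, ih, ih]
    simp

/-- An event which does not depend on the elements outside of `Λ` has the same probability in
every larger set. -/
lemma unif_eq_of_subset {Λ Λ' : Finset α} (h : Λ ⊆ Λ') {A : Finset α → Prop}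
    (hA : ∀ S, A S ↔ A (S ∩ Λ)) : unif Λ' A = unif Λ A := by
  obtain ⟨Δ, rfl, hd⟩ : ∃ Δ, Λ' = Δ ∪ Λ ∧ Disjoint Δ Λ :=
    ⟨Λ' \ Λ, (Finset.sdiff_union_of_subset h).symm, Finset.sdiff_disjoint⟩
  clear h
  induction Δ using Finset.induction_on with
  | empty => simp
  | insert a Δ ha ih =>
    rw [Finset.disjoint_insert_left] at hd
    rw [Finset.insert_union, unif_insert (by simp [ha, hd.1])]
    have : unif (Δ ∪ Λ) (fun S => A (insert a S)) = unif (Δ ∪ Λ) A := by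
      refine unif_congr fun S _ => ?_
      rw [hA, hA S, Finset.insert_inter_of_notMem hd.1]
    rw [this, ih hd.2]; ring

lemma Increasing.comp_insert {A : Finset α → Prop} (hA : Increasing A) (a : α) :
    Increasing (fun S => A (insert a S)) :=
  fun _ _ h => hA _ _ (Finset.insert_subset_insert a h)

lemma Increasing.unif_le {A : Finset α → Prop} (hA : Increasing A) (a : α) (Λ : Finset α) :
    unif Λ A ≤ unif Λ (fun S => A (insert a S)) :=
  unif_mono fun S _ => hA _ _ (Finset.subset_insert a S)

/-- Increasing events become more likely when elements become more likely. -/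
lemma Increasing.bern_le_unif {A : Finset α → Prop} (hA : Increasing A) {q : ℝ} (h0 : 0 ≤ q)
    (h1 : q ≤ 1 / 2) (Λ : Finset α) : bern q Λ A ≤ unif Λ A := by
  classical
  induction Λ using Finset.induction_on generalizing A with
  | empty => simp [unif, bern_empty]
  | insert a Λ ha ih =>
    rw [unif_insert ha, bern_insert _ ha]
    have e1 := ih hA
    have e2 := ih (hA.comp_insert a)
    have e3 := hA.unif_le a Λ
    nlinarith

/-- The Harris inequality. -/
lemma Increasing.unif_mul_le_unif_and {A B : Finset α → Prop} (hA : Increasing A)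
    (hB : Increasing B) (Λ : Finset α) :
    unif Λ A * unif Λ B ≤ unif Λ (fun S => A S ∧ B S) := by
  classical
  induction Λ using Finset.induction_on generalizing A B with
  | empty => by_cases h1 : A ∅ <;> by_cases h2 : B ∅ <;> simp [unif, bern_empty, h1, h2]
  | insert a Λ ha ih =>
    rw [unif_insert ha, unif_insert ha, unif_insert ha]
    have e1 := ih hA hB
    have e2 := ih (hA.comp_insert a) (hB.comp_insert a)
    have e3 := hA.unif_le a Λ
    have e4 := hB.unif_le a Λ
    nlinarith [mul_nonneg (sub_nonneg.2 e3) (sub_nonneg.2 e4)]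

/-- The van den Berg–Kesten inequality for increasing events. -/
lemma Increasing.unif_disjOcc_le {A B : Finset α → Prop} (hA : Increasing A) (hB : Increasing B)
    (Λ : Finset α) : unif Λ (DisjOcc A B) ≤ unif Λ A * unif Λ B := by
  classical
  induction Λ using Finset.induction_on generalizing A B with
  | empty =>
    have : DisjOcc A B ∅ ↔ A ∅ ∧ B ∅ := by
      constructor
      · rintro ⟨T₁, T₂, h1, h2, -, h4, h5⟩
        rw [Finset.subset_empty] at h1 h2
        subst h1; subst h2; exact ⟨h4, h5⟩
      · rintro ⟨h1, h2⟩; exact ⟨∅, ∅, by simp, by simp, by simp, h1, h2⟩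
    by_cases h1 : A ∅ <;> by_cases h2 : B ∅ <;> simp [unif, bern_empty, h1, h2, this]
  | insert a Λ ha ih =>
    rw [unif_insert ha, unif_insert ha, unif_insert ha]
    set A' : Finset α → Prop := fun S => A (insert a S) with hA'
    set B' : Finset α → Prop := fun S => B (insert a S) with hB'
    have iA : ∀ S, A S → A' S := fun S => hA _ _ (Finset.subset_insert a S)
    have iB : ∀ S, B S → B' S := fun S => hB _ _ (Finset.subset_insert a S)
    have e1 := ih hA (hB.comp_insert a)
    have e2 := ih (hA.comp_insert a) hB
    have e3 := hA.unif_le a Λ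
    have e4 := hB.unif_le a Λ
    -- If `a` is absent, disjoint occurrence implies both mixed events; if `a` is present, at most
    -- one witness uses it, so one of the mixed events occurs. Thus the two conditional
    -- probabilities add up to at most the sum for the mixed events, which the induction bounds; a
    -- rearrangement inequality finishes.
    have e5 := unif_or_add_and Λ (DisjOcc A B') (DisjOcc A' B)
    have e6 : unif Λ (DisjOcc A B) ≤ unif Λ (fun S => DisjOcc A B' S ∧ DisjOcc A' B S) :=
      unif_mono fun S _ h => ⟨h.mono (fun _ => id) iB, h.mono iA fun _ => id⟩
    have e7 : unif Λ (fun S => DisjOcc A B (insert a S)) ≤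
        unif Λ (fun S => DisjOcc A B' S ∨ DisjOcc A' B S) := by
      refine unif_mono fun S _ => ?_
      rintro ⟨T₁, T₂, h1, h2, h3, h4, h5⟩
      by_cases hT : a ∈ T₁
      · right
        have hT2 : a ∉ T₂ := Finset.disjoint_left.1 h3 hT
        refine ⟨T₁.erase a, T₂, ?_, (Finset.subset_insert_iff_of_notMem hT2).1 h2,
          Finset.disjoint_of_subset_left (Finset.erase_subset _ _) h3, ?_, h5⟩
        · rwa [← Finset.subset_insert_iff]
        · simpa only [hA', Finset.insert_erase hT] using h4
      · left
        refine ⟨T₁, T₂.erase a, (Finset.subset_insert_iff_of_notMem hT).1 h1, ?_,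
          Finset.disjoint_of_subset_right (Finset.erase_subset _ _) h3, h4, ?_⟩
        · rwa [← Finset.subset_insert_iff]
        · refine hB _ _ (fun z hz => ?_) h5
          by_cases hza : z = a <;> simp [hza, hz]
    nlinarith [mul_nonneg (sub_nonneg.2 e3) (sub_nonneg.2 e4)]

lemma unif_disjOccs_le {A : ℕ → Finset α → Prop} (hA : ∀ i, Increasing (A i)) (Λ : Finset α)
    (n : ℕ) : unif Λ (DisjOccs A n) ≤ ∏ i ∈ Finset.range n, unif Λ (A i) := by
  induction n with
  | zero => simp [DisjOccs, unif_true]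
  | succ n ih =>
    rw [Finset.prod_range_succ]
    exact ((increasing_disjOccs A n).unif_disjOcc_le (hA n) Λ).trans
      (mul_le_mul_of_nonneg_right ih (unif_nonneg _ _))

lemma disjOccs_of_disjoint {A : ℕ → Finset α → Prop} {n : ℕ} {S : Finset α}
    (W : ℕ → Finset α) (hW : ∀ i < n, W i ⊆ S ∧ A i (W i))
    (hd : ∀ i j, i < j → j < n → Disjoint (W i) (W j)) : DisjOccs A n S := by
  induction n generalizing S with
  | zero => trivial
  | succ n ih =>
    refine ⟨(Finset.range n).biUnion W, W n, ?_, (hW n n.lt_succ_self).1, ?_, ?_,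
      (hW n n.lt_succ_self).2⟩
    · exact Finset.biUnion_subset.2 fun i hi =>
        (hW i ((Finset.mem_range.1 hi).trans n.lt_succ_self)).1
    · exact (Finset.disjoint_biUnion_left _ _ _).2 fun i hi =>
        hd i n (Finset.mem_range.1 hi) n.lt_succ_self
    · exact ih (fun i hi => ⟨Finset.subset_biUnion_of_mem W (Finset.mem_range.2 hi),
        (hW i (hi.trans n.lt_succ_self)).2⟩) fun i j hij hj => hd i j hij (hj.trans n.lt_succ_self)

end Cube

/-! ### Connections inside a set -/

/-- `u` and `v` are linked in `A`: there is an `r`-path from `u` to `v` which stays in `A`. -/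
def Linked {α : Type*} (r : α → α → Prop) (A : Set α) (u v : α) : Prop :=
  u ∈ A ∧ Relation.ReflTransGen (fun a b => r a b ∧ b ∈ A) u v

section Linked

variable {α : Type*} {r : α → α → Prop} {A B : Set α} {u v w : α}

lemma Linked.refl (h : u ∈ A) : Linked r A u u := ⟨h, .refl⟩

lemma Linked.left (h : Linked r A u v) : u ∈ A := h.1

lemma Linked.tail (h : Linked r A u v) (hr : r v w) (hw : w ∈ A) : Linked r A u w :=
  ⟨h.1, h.2.tail ⟨hr, hw⟩⟩

lemma Linked.trans (h : Linked r A u v) (h' : Linked r A v w) : Linked r A u w :=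
  ⟨h.1, h.2.trans h'.2⟩

lemma Linked.head (hu : u ∈ A) (hr : r u v) (h : Linked r A v w) : Linked r A u w :=
  ((Linked.refl hu).tail hr h.1).trans h

/-- Induction along a path. -/
@[elab_as_elim]
lemma Linked.induct {P : α → Prop} (h : Linked r A u v) (h0 : P u)
    (hs : ∀ a b, Linked r A u a → r a b → b ∈ A → P a → P b) : P v := by
  obtain ⟨hu, h⟩ := h
  induction h with
  | refl => exact h0
  | tail h1 h2 ih => exact hs _ _ ⟨hu, h1⟩ h2.1 h2.2 ih

lemma Linked.right (h : Linked r A u v) : v ∈ A :=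
  h.induct h.1 fun _ _ _ _ hb _ => hb

lemma Linked.mono (hAB : A ⊆ B) (h : Linked r A u v) : Linked r B u v :=
  h.induct (.refl (hAB h.1)) fun _ _ _ hr hb ih => ih.tail hr (hAB hb)

lemma Linked.symm (hr : ∀ a b, r a b → r b a) (h : Linked r A u v) : Linked r A v u :=
  h.induct (.refl h.1) fun a b _ hab hb ih => .head hb (hr a b hab) ih

/-- A path is contained in the set of the points linked to its starting point. -/
lemma Linked.linked (h : Linked r A u v) : Linked r {z | Linked r A u z} u v :=
  h.induct (.refl (.refl h.1)) fun _ _ ha hr hb ih => ih.tail hr (ha.tail hr hb)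

lemma Linked.map {β : Type*} {r' : β → β → Prop} {A' : Set β} (f : α → β)
    (hr : ∀ a b, r a b → r' (f a) (f b)) (hA : ∀ a ∈ A, f a ∈ A') (h : Linked r A u v) :
    Linked r' A' (f u) (f v) :=
  h.induct (.refl (hA _ h.1)) fun _ b _ hab hb ih => ih.tail (hr _ _ hab) (hA b hb)

/-- Backward induction along a path. -/
lemma Linked.induct_back {P : α → Prop} (h : Linked r A u v) (h0 : P v)
    (hs : ∀ a b, r a b → a ∈ A → b ∈ A → P b → P a) : P u := by
  revert h0
  exact h.induct id fun a b ha hr hb ih hPb => ih (hs a b hr ha.right hb hPb)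

end Linked

/-! ### The Hex theorem -/

/-- The rectangle of the points of `ℤ²` with coordinates in `[x₀, x₁]` and `[y₀, y₁]`. -/
def rect (x₀ x₁ y₀ y₁ : ℤ) : Set Site := {z | (x₀ ≤ z.1 ∧ z.1 ≤ x₁) ∧ y₀ ≤ z.2 ∧ z.2 ≤ y₁}

lemma mem_rect {x₀ x₁ y₀ y₁ : ℤ} {z : Site} :
    z ∈ rect x₀ x₁ y₀ y₁ ↔ (x₀ ≤ z.1 ∧ z.1 ≤ x₁) ∧ y₀ ≤ z.2 ∧ z.2 ≤ y₁ := Iff.rfl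

/-- A symmetric relation on `ℤ²` which contains a triangulation of the plane whose vertical and
horizontal edges are those of the square lattice. -/
structure IsGrid (r : Site → Site → Prop) : Prop where
  symm : ∀ u v, r u v → r v u
  horiz : ∀ x y, r (x, y) (x + 1, y)
  vert : ∀ x y, r (x, y) (x, y + 1)
  diag : ∀ x y, r (x + 1, y) (x, y + 1) ∨ r (x, y) (x + 1, y + 1)

open Classical in
/-- The number modulo two of the pairs `(u, v)`, `(v, u)` which lie in `C × X`. -/
def edgeParity (C X : Set Site) (u v : Site) : ZMod 2 :=
  (if u ∈ C ∧ v ∈ X then 1 else 0) + (if v ∈ C ∧ u ∈ X then 1 else 0)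

/-- A triangle that meets both `C` and `X` has its third vertex in one of them, so exactly two of
its edges join `C` to `X`; any other triangle has no such edge. -/
lemma edgeParity_triangle {C X : Set Site} (hCX : Disjoint C X) {a b c : Site}
    (h : ∀ p ∈ ({a, b, c} : Set Site), p ∉ C → (∃ q ∈ ({a, b, c} : Set Site), q ∈ C) →
      (∃ q ∈ ({a, b, c} : Set Site), q ∈ X) → p ∈ X) :
    edgeParity C X a b + edgeParity C X b c + edgeParity C X a c = 0 := by
  have d : ∀ p, p ∈ C → p ∉ X := fun p hp => Set.disjoint_left.1 hCX hp
  have ha := d a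
  have hb := d b
  have hc := d c
  have h1 := h a (by simp)
  have h2 := h b (by simp)
  have h3 := h c (by simp)
  simp only [Set.mem_insert_iff, Set.mem_singleton_iff, exists_eq_or_imp, exists_eq_left] at h1 h2 h3
  unfold edgeParity
  by_cases a1 : a ∈ C <;> by_cases a2 : b ∈ C <;> by_cases a3 : c ∈ C <;>
    by_cases b1 : a ∈ X <;> by_cases b2 : b ∈ X <;> by_cases b3 : c ∈ X <;>
    simp_all <;> decide

/-- The **Hex theorem**: in a coloured rectangle there is a path in the colour `W` from the left
to the right or a path in the other colour from the bottom to the top. -/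
theorem IsGrid.hex {r : Site → Site → Prop} (hr : IsGrid r) (W : Set Site) {x₀ x₁ y₀ y₁ : ℤ}
    (hx : x₀ ≤ x₁) (hy : y₀ ≤ y₁) :
    (∃ u v, u.1 = x₀ ∧ v.1 = x₁ ∧ Linked r (W ∩ rect x₀ x₁ y₀ y₁) u v) ∨
    ∃ u v, u.2 = y₀ ∧ v.2 = y₁ ∧ Linked r (rect x₀ x₁ y₀ y₁ \ W) u v := by
  classical
  by_contra hcon
  push Not at hcon
  obtain ⟨hW, hB⟩ := hcon
  set Q := rect x₀ x₁ y₀ y₁ with hQ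
  -- `C` is the cluster of the bottom in the colour other than `W`, started from an extra row below
  -- the rectangle; `F` is its outer boundary and `X` the part of `F` linked to the left side. The
  -- contradiction comes from counting modulo 2 the edges between `C` and `X` in each column.
  set C : Set Site := {z | z.2 = y₀ - 1 ∨ ∃ u, u.2 = y₀ ∧ Linked r (Q \ W) u z} with hC
  set F : Set Site := {z | z ∈ W ∩ Q ∧ ∃ c ∈ C, r c z} with hF
  set X : Set Site := {z | ∃ u, u.1 = x₀ ∧ Linked r F u z} with hX
  have hFC : Disjoint F C := by
    rw [Set.disjoint_left]
    rintro z ⟨⟨hz1, hz2⟩, -⟩ (hz | ⟨u, -, hz⟩)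
    · have := hz2.2.1; omega
    · exact hz.right.2 hz1
  have hXF : X ⊆ F := fun z ⟨u, _, h⟩ => h.right
  have hCX : Disjoint C X := (hFC.mono_left hXF).symm
  -- a point of the rectangle next to the cluster belongs to the cluster or to its boundary
  have hnext : ∀ c ∈ C, ∀ z ∈ Q, r c z → (c.2 = y₀ - 1 → z.2 = y₀) → z ∈ C ∨ z ∈ F := by
    intro c hc z hz hcz h0
    by_cases hzW : z ∈ W
    · exact Or.inr ⟨⟨hzW, hz⟩, c, hc, hcz⟩
    · left
      rcases hc with hc' | ⟨u, hu, huc⟩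
      · exact Or.inr ⟨z, h0 hc', .refl ⟨hz, hzW⟩⟩
      · exact Or.inr ⟨u, hu, huc.tail hcz ⟨hz, hzW⟩⟩
  have htop : ∀ x, (x, y₁) ∉ C := by
    rintro x (h | ⟨u, hu, h⟩)
    · simp only at h; omega
    · exact hB u _ hu rfl h
  have hbot : ∀ x, (x, y₀ - 1) ∈ C := fun x => Or.inl rfl
  have tri : ∀ a b c : Site, (∀ p ∈ ({a, b, c} : Set Site), p.2 = y₀ - 1 ∨ p ∈ Q) →
      (∀ p ∈ ({a, b, c} : Set Site), ∀ q ∈ ({a, b, c} : Set Site), q ≠ p → r p q) →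
      (∀ p ∈ ({a, b, c} : Set Site), ∀ q ∈ ({a, b, c} : Set Site), q.2 ≤ p.2 + 1) →
      edgeParity C X a b + edgeParity C X b c + edgeParity C X a c = 0 := by
    intro a b c h1 h2 h3
    refine edgeParity_triangle hCX ?_
    rintro p hp hpC ⟨q, hq, hqC⟩ ⟨z, hz, hzX⟩
    have hpQ : p ∈ Q := (h1 p hp).resolve_left fun h => hpC (Or.inl h)
    have hqp : p ≠ q := by rintro rfl; exact hpC hqC
    have hpF : p ∈ F := (hnext q hqC p hpQ (h2 q hq p hp hqp) fun h => by
      have := h3 q hq p hp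
      have := hpQ.2.1
      omega).resolve_left hpC
    by_cases hpz : p = z
    · exact hpz ▸ hzX
    · obtain ⟨u, hu, huz⟩ := hzX
      exact ⟨u, hu, huz.tail (h2 z hz p hp hpz) hpF⟩
  obtain ⟨n, hn⟩ : ∃ n : ℕ, y₁ = y₀ - 1 + n := ⟨(y₁ - (y₀ - 1)).toNat, by omega⟩
  set N : ℤ → ZMod 2 := fun x =>
    ∑ i ∈ Finset.range n, edgeParity C X (x, y₀ - 1 + i) (x, y₀ - 1 + i + 1) with hN
  have hstep : ∀ x, x₀ ≤ x → x + 1 ≤ x₁ → N x = N (x + 1) := by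
    intro x h1 h2
    have key : ∀ i ∈ Finset.range n,
        edgeParity C X (x, y₀ - 1 + i) (x, y₀ - 1 + i + 1) +
          edgeParity C X (x + 1, y₀ - 1 + i) (x + 1, y₀ - 1 + i + 1) =
        edgeParity C X (x, y₀ - 1 + (i + 1 : ℕ)) (x + 1, y₀ - 1 + (i + 1 : ℕ)) -
          edgeParity C X (x, y₀ - 1 + (i : ℕ)) (x + 1, y₀ - 1 + (i : ℕ)) := by
      intro i hi
      have hi' := Finset.mem_range.1 hi
      push_cast
      rw [← add_assoc]
      set y := y₀ - 1 + (i : ℤ) with hy'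
      have e1 : y₀ - 1 ≤ y := by omega
      have e2 : y + 1 ≤ y₁ := by omega
      have m1 : (x, y).2 = y₀ - 1 ∨ (x, y) ∈ Q := by
        simp only [hQ, mem_rect]; omega
      have m2 : (x + 1, y).2 = y₀ - 1 ∨ (x + 1, y) ∈ Q := by
        simp only [hQ, mem_rect]; omega
      have m3 : (x, y + 1).2 = y₀ - 1 ∨ (x, y + 1) ∈ Q := by
        simp only [hQ, mem_rect]; omega
      have m4 : (x + 1, y + 1).2 = y₀ - 1 ∨ (x + 1, y + 1) ∈ Q := by
        simp only [hQ, mem_rect]; omega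
      have r1 := hr.horiz x y
      have r1' := hr.symm _ _ r1
      have r2 := hr.horiz x (y + 1)
      have r2' := hr.symm _ _ r2
      have r3 := hr.vert x y
      have r3' := hr.symm _ _ r3
      have r4 := hr.vert (x + 1) y
      have r4' := hr.symm _ _ r4
      have two : ∀ t : ZMod 2, t + t = 0 := by decide
      have comm : ∀ u v, edgeParity C X u v = edgeParity C X v u := fun u v => add_comm _ _
      rcases hr.diag x y with r5 | r5
      · have r5' := hr.symm _ _ r5
        have t1 := tri (x, y) (x + 1, y) (x, y + 1) (by simp [m1, m2, m3])
          (by simp [r1, r1', r3, r3', r5, r5'])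
          (by simp [add_assoc])
        have t2 := tri (x + 1, y) (x, y + 1) (x + 1, y + 1) (by simp [m4, m2, m3])
          (by simp [r2, r2', r4, r4', r5, r5'])
          (by simp [add_assoc])
        have := two (edgeParity C X (x + 1, y) (x, y + 1))
        have := two (edgeParity C X (x, y + 1) (x + 1, y + 1))
        linear_combination t1 + t2 - two (edgeParity C X (x + 1, y) (x, y + 1))
          - two (edgeParity C X (x, y + 1) (x + 1, y + 1))
      · have r5' := hr.symm _ _ r5
        have t1 := tri (x, y) (x + 1, y) (x + 1, y + 1) (by simp [m1, m2, m4])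
          (by simp [r1, r1', r4, r4', r5, r5'])
          (by simp [add_assoc])
        have t2 := tri (x, y) (x, y + 1) (x + 1, y + 1) (by simp [m4, m1, m3])
          (by simp [r2, r2', r3, r3', r5, r5'])
          (by simp [add_assoc])
        linear_combination t1 + t2 - two (edgeParity C X (x, y) (x + 1, y + 1))
          - two (edgeParity C X (x, y + 1) (x + 1, y + 1))
    -- The sum up the strip between two columns telescopes to its two extreme horizontal edges.
    -- Neither joins `C` to `X`: the lowest has both ends in `C`, the highest has none.
    have hs := Finset.sum_congr (rfl : Finset.range n = _) key
    rw [Finset.sum_add_distrib, Finset.sum_range_sub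
      (fun i : ℕ => edgeParity C X (x, y₀ - 1 + (i : ℕ)) (x + 1, y₀ - 1 + (i : ℕ)))] at hs
    have b1 : edgeParity C X (x, y₀ - 1 + (n : ℕ)) (x + 1, y₀ - 1 + (n : ℕ)) = 0 := by
      rw [← hn]; simp [edgeParity, htop]
    have b2 : edgeParity C X (x, y₀ - 1 + (0 : ℕ)) (x + 1, y₀ - 1 + (0 : ℕ)) = 0 := by
      have d : ∀ p, p ∈ C → p ∉ X := fun p hp => Set.disjoint_left.1 hCX hp
      simp [edgeParity, d _ (hbot _)]
    rw [b1, b2, sub_zero] at hs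
    have := ZModModule.add_self (N (x + 1))
    calc N x = (N x + N (x + 1)) + N (x + 1) := by rw [add_assoc, this, add_zero]
      _ = N (x + 1) := by rw [show N x + N (x + 1) = 0 from hs, zero_add]
  -- In the leftmost column a point of `F` is in `X`, so the edges between `C` and `X` are exactly
  -- the changes between `C` and its complement. The column starts in `C` and ends outside, so there
  -- is an odd number of them.
  have hfirst : N x₀ = 1 := by
    have key : ∀ i ∈ Finset.range n,
        edgeParity C X (x₀, y₀ - 1 + i) (x₀, y₀ - 1 + i + 1) =
        (if (x₀, y₀ - 1 + ((i + 1 : ℕ) : ℤ)) ∈ C then 1 else 0) -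
          (if (x₀, y₀ - 1 + (i : ℤ)) ∈ C then 1 else 0) := by
      intro i hi
      have hi' := Finset.mem_range.1 hi
      push_cast
      rw [← add_assoc]
      set y := y₀ - 1 + (i : ℤ) with hy'
      have d : ∀ p, p ∈ C → p ∉ X := fun p hp => Set.disjoint_left.1 hCX hp
      have r1 := hr.vert x₀ y
      have in_X : ∀ c z : Site, c ∈ C → z ∉ C → r c z → z.1 = x₀ → z.2 ≤ y₁ →
          z.2 ≤ c.2 + 1 → y₀ - 1 ≤ z.2 → z ∈ X := by
        intro c z hc hz hcz h1 h2 h3 h4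
        have h5 : z.2 ≠ y₀ - 1 := fun h => hz (Or.inl h)
        have hzQ : z ∈ Q := ⟨⟨by omega, by omega⟩, by omega, h2⟩
        exact ⟨z, h1, .refl ((hnext c hc z hzQ hcz fun h => by omega).resolve_left hz)⟩
      unfold edgeParity
      by_cases c1 : (x₀, y) ∈ C <;> by_cases c2 : (x₀, y + 1) ∈ C
      · simp [c1, c2, d]
      · have := in_X _ _ c1 c2 r1 rfl (by simp only; omega) (by simp) (by simp only; omega)
        simp [c1, c2, this]
      · have := in_X _ _ c2 c1 (hr.symm _ _ r1) rfl (by simp only; omega) (by simp only; omega)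
          (by simp only; omega)
        simp [c1, c2, this]
      · simp [c1, c2]
    rw [hN]
    simp only
    rw [Finset.sum_congr rfl key,
      Finset.sum_range_sub (fun i : ℕ => if (x₀, y₀ - 1 + (i : ℤ)) ∈ C then (1 : ZMod 2) else 0),
      ← hn, if_neg (htop _)]
    simp [hbot]
  have hall : ∀ k : ℕ, x₀ + k ≤ x₁ → N (x₀ + k) = 1 := by
    intro k
    induction k with
    | zero => simpa using fun _ => hfirst
    | succ k ih =>
      intro hk
      push_cast at hk ⊢
      rw [← add_assoc, ← hstep _ (by omega) (by omega)]
      exact ih (by omega)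
  have hlast : N x₁ = 1 := by
    have := hall (x₁ - x₀).toNat (by omega)
    rwa [show x₀ + ((x₁ - x₀).toNat : ℤ) = x₁ by omega] at this
  have hzero : N x₁ = 0 := by
    have hX1 : ∀ y, (x₁, y) ∉ X := by
      rintro y ⟨u, hu, h⟩
      exact hW u _ hu rfl (h.mono fun z hz => hz.1)
    simp [hN, edgeParity, hX1]
  exact one_ne_zero (hlast.symm.trans hzero)

/-! ### The brick coordinates of the triangular lattice -/

/-- Adjacency in the triangular lattice in the coordinates `(x, y) = (a + ⌊b / 2⌋, b)`, for which
the reflection `(x, y) ↦ (x, -y)` is an automorphism. -/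
def Brick (u v : Site) : Prop :=
  (u.2 = v.2 ∧ (v.1 = u.1 + 1 ∨ u.1 = v.1 + 1)) ∨
  ((v.2 = u.2 + 1 ∨ u.2 = v.2 + 1) ∧
    (v.1 = u.1 ∨ (u.2 % 2 = 0 ∧ v.1 = u.1 - 1) ∨ (u.2 % 2 = 1 ∧ v.1 = u.1 + 1)))

lemma Brick.symm {u v : Site} (h : Brick u v) : Brick v u := by
  unfold Brick at *; omega

lemma isGrid_brick : IsGrid Brick where
  symm _ _ := Brick.symm
  horiz x y := by unfold Brick; simp
  vert x y := by unfold Brick; simp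
  diag x y := by rcases Int.emod_two_eq y with h | h <;> simp [Brick, h]

lemma Linked.brick_symm {A : Set Site} {u v : Site} (h : Linked Brick A u v) :
    Linked Brick A v u :=
  h.symm fun _ _ => Brick.symm

open Classical in
/-- Indicator of a proposition in `ZMod 2`. -/
def ind (p : Prop) : ZMod 2 := if p then 1 else 0

lemma ind_add_self (p : Prop) : ind p + ind p = 0 := CharTwo.add_self_eq_zero _

/-- The step between `u` and `v` passes above the right neighbour edge of the point `q`. -/
def PassesAbove (u v q : Site) : Prop :=
  (u.1 = q.1 ∧ v.1 = q.1 + 1 ∧ q.2 < u.2) ∨ (v.1 = q.1 ∧ u.1 = q.1 + 1 ∧ q.2 < v.2)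

lemma passesAbove_iff_of_vert {a b q q' : Site} (h1 : q' ≠ a) (h2 : q' ≠ b)
    (h3 : q ≠ a) (h4 : q ≠ b) (hq : Brick q q') (hqq : q.1 = q'.1) :
    PassesAbove a b q ↔ PassesAbove a b q' := by
  rw [Ne, Prod.ext_iff] at h1 h2 h3 h4
  unfold PassesAbove Brick at *
  omega

/-- Consider the vertical ray above `q'`. Steps counted at `q` or `q'` are those that enter or leave
this ray from the left or from the right, so modulo 2 the count is the number of endpoints of the
step on the ray. -/
lemma ind_passesAbove_add {a b q q' : Site} (hab : Brick a b) (h1 : q' ≠ a) (h2 : q' ≠ b)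
    (h3 : q ≠ a) (h4 : q ≠ b) (hq : Brick q q') (hqq : q'.1 = q.1 + 1) :
    ind (PassesAbove a b q) + ind (PassesAbove a b q') =
      ind (a.1 = q'.1 ∧ q'.2 < a.2) + ind (b.1 = q'.1 ∧ q'.2 < b.2) := by
  rw [Ne, Prod.ext_iff] at h1 h2 h3 h4
  have hcol : b.1 = a.1 ∨ b.1 = a.1 + 1 ∨ a.1 = b.1 + 1 := by unfold Brick at hab; omega
  rcases hcol with h | h | h
  · have e1 : ¬ PassesAbove a b q := by unfold PassesAbove; omega
    have e2 : ¬ PassesAbove a b q' := by unfold PassesAbove; omega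
    have e3 : (a.1 = q'.1 ∧ q'.2 < a.2) ↔ (b.1 = q'.1 ∧ q'.2 < b.2) := by
      unfold Brick at hab; omega
    simp only [e3, ind_add_self]
    simp [ind, e1, e2]
  · have e1 : PassesAbove a b q ↔ (b.1 = q'.1 ∧ q'.2 < b.2) := by
      unfold Brick PassesAbove at *; omega
    have e2 : PassesAbove a b q' ↔ (a.1 = q'.1 ∧ q'.2 < a.2) := by
      unfold PassesAbove; omega
    rw [e1, e2, add_comm]
  · have e1 : PassesAbove a b q ↔ (a.1 = q'.1 ∧ q'.2 < a.2) := by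
      unfold Brick PassesAbove at *; omega
    have e2 : PassesAbove a b q' ↔ (b.1 = q'.1 ∧ q'.2 < b.2) := by
      unfold PassesAbove; omega
    rw [e1, e2]

/-- The number of times, modulo two, that a path passes above a point. -/
lemma Linked.exists_parity {A : Set Site} {u v : Site} (h : Linked Brick A u v) :
    ∃ N : Site → ZMod 2,
      (∀ q q', q ∉ A → q' ∉ A → Brick q q' → q.1 = q'.1 → N q = N q') ∧
      (∀ q q', q ∉ A → q' ∉ A → Brick q q' → q'.1 = q.1 + 1 →
        N q + N q' = ind (u.1 = q'.1 ∧ q'.2 < u.2) + ind (v.1 = q'.1 ∧ q'.2 < v.2)) ∧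
      (∀ q, (∀ z ∈ A, z.2 ≤ q.2) → N q = 0) ∧
      (∀ q, q ∉ A → (∀ z ∈ A, q.2 ≤ z.2) → N q = ind (u.1 ≤ q.1) + ind (v.1 ≤ q.1)) := by
  refine h.induct ?_ ?_
  · exact ⟨0, by simp, by simp [ind_add_self], by simp, by simp [ind_add_self]⟩
  · rintro a b ha hab hb ⟨N, h1, h2, h3, h4⟩
    have ha := ha.right
    have ne : ∀ q, q ∉ A → q ≠ a ∧ q ≠ b := fun q hq =>
      ⟨fun h => hq (h ▸ ha), fun h => hq (h ▸ hb)⟩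
    refine ⟨fun q => N q + ind (PassesAbove a b q), ?_, ?_, ?_, ?_⟩
    · intro q q' hq hq' hqq he
      simp only [h1 q q' hq hq' hqq he, passesAbove_iff_of_vert (ne q' hq').1 (ne q' hq').2
        (ne q hq).1 (ne q hq).2 hqq he]
    · intro q q' hq hq' hqq he
      have e1 := h2 q q' hq hq' hqq he
      have e2 := ind_passesAbove_add hab (ne q' hq').1 (ne q' hq').2
        (ne q hq).1 (ne q hq).2 hqq he
      have e3 := ind_add_self (a.1 = q'.1 ∧ q'.2 < a.2)
      linear_combination e1 + e2 + e3
    · intro q hq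
      have : ¬ PassesAbove a b q := by
        have := hq a ha; have := hq b hb
        unfold PassesAbove; omega
      simp [h3 q hq, ind, this]
    · intro q hqA hq
      have e1 := h4 q hqA hq
      have e2 : ind (PassesAbove a b q) + ind (a.1 ≤ q.1) = ind (b.1 ≤ q.1) := by
        have k1 := hq a ha
        have k2 := hq b hb
        have k3 := (ne q hqA).1
        have k4 := (ne q hqA).2
        rw [Ne, Prod.ext_iff] at k3 k4
        have key : PassesAbove a b q ↔ ¬ (a.1 ≤ q.1 ↔ b.1 ≤ q.1) := by
          unfold PassesAbove Brick at *
          omega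
        unfold ind
        by_cases p3 : a.1 ≤ q.1 <;> by_cases p4 : b.1 ≤ q.1 <;> simp [key, p3, p4]; decide
      linear_combination e1 + e2

/-- A path from the left to the right and a path from the bottom to the top intersect. -/
theorem Linked.inter_nonempty {A B : Set Site} {u v p q : Site} (hA : Linked Brick A u v)
    (hB : Linked Brick B p q) (hu : ∀ z ∈ B, u.1 ≤ z.1) (hv : ∀ z ∈ B, z.1 ≤ v.1)
    (hp : ∀ z ∈ A, p.2 ≤ z.2) (hq : ∀ z ∈ A, z.2 ≤ q.2) : (A ∩ B).Nonempty := by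
  by_contra hne
  rw [Set.not_nonempty_iff_eq_empty, ← Set.disjoint_iff_inter_eq_empty, Set.disjoint_left] at hne
  -- Prolonging the path to the right of all columns of `B` keeps its endpoint from contributing to
  -- the parity along `B`.
  set v' : Site := (v.1 + 1, v.2) with hv'
  set A' : Set Site := insert v' A with hA'
  have hv'B : v' ∉ B := fun h => by have := hv _ h; simp [hv'] at this
  have hA2 : Linked Brick A' u v' :=
    (hA.mono (Set.subset_insert _ _)).tail (by simp [Brick, hv']) (Set.mem_insert _ _)
  have rows : ∀ P : ℤ → Prop, (∀ z ∈ A, P z.2) → ∀ z ∈ A', P z.2 := by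
    rintro P h z (rfl | hz)
    exacts [h v hA.right, h z hz]
  have hB' : ∀ z ∈ B, z ∉ A' := by
    rintro z hz (rfl | h)
    exacts [hv'B hz, hne h hz]
  -- The parity of the passages of the first path above a point is constant along a disjoint second
  -- path; yet it is 1 at `p`, below the whole path, and 0 at `q`, above it.
  obtain ⟨N, h1, h2, h3, h4⟩ := hA2.exists_parity
  have hconst : N q = N p := by
    refine hB.induct rfl fun a b ha hab hb ih => ?_
    have ha := ha.right
    rw [← ih]
    have horiz : ∀ a b, a ∈ B → b ∈ B → Brick a b → b.1 = a.1 + 1 → N a = N b := by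
      intro a b ha hb hab he
      have := h2 a b (hB' a ha) (hB' b hb) hab he
      have e1 : ¬ (u.1 = b.1 ∧ b.2 < u.2) := fun h => by have := hu a ha; omega
      have e2 : ¬ (v'.1 = b.1 ∧ b.2 < v'.2) := fun h => by
        have := hv b hb
        simp only [hv'] at h; omega
      simp only [ind, e1, e2, if_false, add_zero] at this
      exact CharTwo.add_eq_zero.1 this
    have : a.1 = b.1 ∨ b.1 = a.1 + 1 ∨ a.1 = b.1 + 1 := by unfold Brick at hab; omega
    rcases this with h | h | h
    · exact (h1 a b (hB' a ha) (hB' b hb) hab h).symm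
    · exact (horiz a b ha hb hab h).symm
    · exact horiz b a hb ha hab.symm h
  rw [h3 q (rows (· ≤ q.2) hq), h4 p (hB' p hB.left) (rows (p.2 ≤ ·) hp)] at hconst
  have e1 := hu p hB.left
  have e2 : ¬ v'.1 ≤ p.1 := by have := hv p hB.left; simp only [hv']; omega
  simp [ind, e1, e2] at hconst

/-! ### Crossings of rectangles -/

/-- The set `S` contains a vertical crossing of a rectangle. -/
def VCross (x₀ x₁ y₀ y₁ : ℤ) (S : Set Site) : Prop :=
  ∃ u v, u.2 = y₀ ∧ v.2 = y₁ ∧ Linked Brick (S ∩ rect x₀ x₁ y₀ y₁) u v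

/-- The set `S` contains a horizontal crossing of a rectangle. -/
def HCross (x₀ x₁ y₀ y₁ : ℤ) (S : Set Site) : Prop :=
  ∃ u v, u.1 = x₀ ∧ v.1 = x₁ ∧ Linked Brick (S ∩ rect x₀ x₁ y₀ y₁) u v

lemma VCross.mono {x₀ x₁ y₀ y₁ : ℤ} {S T : Set Site} (h : S ∩ rect x₀ x₁ y₀ y₁ ⊆ T) :
    VCross x₀ x₁ y₀ y₁ S → VCross x₀ x₁ y₀ y₁ T := by
  rintro ⟨u, v, hu, hv, huv⟩
  exact ⟨u, v, hu, hv, huv.mono fun z hz => ⟨h hz, hz.2⟩⟩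

lemma HCross.mono {x₀ x₁ y₀ y₁ : ℤ} {S T : Set Site} (h : S ∩ rect x₀ x₁ y₀ y₁ ⊆ T) :
    HCross x₀ x₁ y₀ y₁ S → HCross x₀ x₁ y₀ y₁ T := by
  rintro ⟨u, v, hu, hv, huv⟩
  exact ⟨u, v, hu, hv, huv.mono fun z hz => ⟨h hz, hz.2⟩⟩

lemma HCross.inter_nonempty {x₀ x₁ y₀ y₁ : ℤ} {S T : Set Site} (hS : HCross x₀ x₁ y₀ y₁ S)
    (hT : VCross x₀ x₁ y₀ y₁ T) : (S ∩ T ∩ rect x₀ x₁ y₀ y₁).Nonempty := by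
  obtain ⟨u, v, hu, hv, huv⟩ := hS
  obtain ⟨p, q, hp, hq, hpq⟩ := hT
  obtain ⟨z, h1, h2⟩ := huv.inter_nonempty hpq (fun z hz => hu ▸ hz.2.1.1)
    (fun z hz => hv ▸ hz.2.1.2) (fun z hz => hp ▸ hz.2.2.1) (fun z hz => hq ▸ hz.2.2.2)
  exact ⟨z, ⟨h1.1, h2.1⟩, h1.2⟩

/-! ### Doubling the length of a crossed rectangle -/

/-- Reflection in the row of height zero. -/
def reflect (z : Site) : Site := (z.1, -z.2)

@[simp] lemma reflect_fst (z : Site) : (reflect z).1 = z.1 := rfl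
@[simp] lemma reflect_snd (z : Site) : (reflect z).2 = -z.2 := rfl
@[simp] lemma reflect_reflect (z : Site) : reflect (reflect z) = z := by simp [reflect]

lemma Brick.reflect {u v : Site} (h : Brick u v) : Brick (reflect u) (reflect v) := by
  unfold Brick at *
  simp only [reflect_fst, reflect_snd]
  omega

lemma reflect_eq {z : Site} (h : z.2 = 0) : reflect z = z := by
  ext <;> simp [h]

section Explore

variable (w h : ℤ) (S : Set Site)

/-- The points of `[0, w] × [0, h]` which are linked to the right side outside of `S`. -/
def rightCluster : Set Site := {z | ∃ u, u.1 = w ∧ Linked Brick (rect 0 w 0 h \ S) u z}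

/-- The points of `S` in `[0, w] × [0, h]` at the boundary of the cluster of the right side. -/
def frontLine : Set Site :=
  {z | z ∈ S ∩ rect 0 w 0 h ∧ (z.1 = w ∨ ∃ c ∈ rightCluster w h S, Brick c z)}

/-- The points that have been explored when the cluster of the right side is known. -/
def explored : Set Site := rightCluster w h S ∪ frontLine w h S

/-- The unexplored points which are linked to the left side by unexplored points. -/
def leftRegion : Set Site := {z | ∃ u, u.1 = 0 ∧ Linked Brick (rect 0 w 0 h \ explored w h S) u z}

/-- The left region and its mirror image. -/
def symRegion : Set Site := {z | z ∈ leftRegion w h S ∨ reflect z ∈ leftRegion w h S}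

/-- Reflect the configuration in the symmetric region and exchange the colours there. -/
def swap : Set Site :=
  {z | (z ∈ S ∧ z ∉ symRegion w h S) ∨ (z ∈ symRegion w h S ∧ reflect z ∉ S)}

/-- There is a path from the top of `[0, w] × [-h, h]` to its bottom or to the lower half of its
left side. -/
def TopToLowerLeft : Prop :=
  ∃ u v : Site, u.2 = h ∧ (v.2 = -h ∨ (v.1 = 0 ∧ v.2 ≤ 0)) ∧
    Linked Brick (S ∩ rect 0 w (-h) h) u v

variable {w h} {S}

lemma rightCluster_subset : rightCluster w h S ⊆ rect 0 w 0 h \ S := fun _ ⟨_, _, hz⟩ => hz.right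

lemma frontLine_subset : frontLine w h S ⊆ S ∩ rect 0 w 0 h := fun _ hz => hz.1

lemma explored_subset : explored w h S ⊆ rect 0 w 0 h := by
  rintro z (hz | hz)
  exacts [(rightCluster_subset hz).1, (frontLine_subset hz).2]

lemma leftRegion_subset : leftRegion w h S ⊆ rect 0 w 0 h \ explored w h S :=
  fun _ ⟨_, _, hz⟩ => hz.right

lemma mem_rightCluster {c z : Site} (hc : c ∈ rightCluster w h S) (hcz : Brick c z)
    (hz : z ∈ rect 0 w 0 h) (hS : z ∉ S) : z ∈ rightCluster w h S := by
  obtain ⟨u, hu, huc⟩ := hc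
  exact ⟨u, hu, huc.tail hcz ⟨hz, hS⟩⟩

lemma mem_explored_of_adj {c z : Site} (hc : c ∈ rightCluster w h S) (hcz : Brick c z)
    (hz : z ∈ rect 0 w 0 h) : z ∈ explored w h S := by
  by_cases hS : z ∈ S
  · exact Or.inr ⟨⟨hS, hz⟩, Or.inr ⟨c, hc, hcz⟩⟩
  · exact Or.inl (mem_rightCluster hc hcz hz hS)

lemma mem_explored_of_right {z : Site} (hz : z ∈ rect 0 w 0 h) (hzw : z.1 = w) :
    z ∈ explored w h S := by
  by_cases hS : z ∈ S
  · exact Or.inr ⟨⟨hS, hz⟩, Or.inl hzw⟩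
  · exact Or.inl ⟨z, hzw, .refl ⟨hz, hS⟩⟩

lemma ne_zero_of_mem_rightCluster (hV : VCross 0 w 0 h S) {z : Site}
    (hz : z ∈ rightCluster w h S) : z.1 ≠ 0 := by
  intro h0
  obtain ⟨u, hu, huz⟩ := hz
  have : HCross 0 w 0 h Sᶜ :=
    ⟨z, u, h0, hu, huz.brick_symm.mono fun y hy => ⟨hy.2, hy.1⟩⟩
  obtain ⟨y, ⟨h1, h2⟩, -⟩ := this.inter_nonempty hV
  exact h1 h2

/-- By the Hex theorem the alternative is a left-right path avoiding the front line. Followed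
backwards from the right side it never leaves the right cluster, which the vertical crossing
prevents from reaching the left side. -/
lemma exists_linked_frontLine (hw : 0 ≤ w) (hh : 0 ≤ h) (hV : VCross 0 w 0 h S) :
    ∃ u v : Site, u.2 = 0 ∧ v.2 = h ∧ Linked Brick (frontLine w h S) u v := by
  rcases isGrid_brick.hex (frontLine w h S)ᶜ hw hh with ⟨u, v, hu, hv, huv⟩ | ⟨u, v, hu, hv, huv⟩
  · exfalso
    refine ne_zero_of_mem_rightCluster hV ?_ hu
    refine huv.induct_back (P := (· ∈ rightCluster w h S)) ?_ ?_
    · have := huv.right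
      exact (mem_explored_of_right this.2 hv).resolve_right this.1
    · intro a b hab ha _ hb
      exact (mem_explored_of_adj hb hab.symm ha.2).resolve_right ha.1
  · exact ⟨u, v, hu, hv, huv.mono fun z hz => not_not.1 hz.2⟩

/-- Such a point lies on the front line. Through it, the right cluster and the left region join the
left side to the right side, and this connection must meet the bottom-top path in the front line.
Both regions being disjoint from the front line, they meet at `z` itself, so `z` is on that path. -/
lemma linked_top_of_adj_leftRegion (hw : 0 ≤ w) (hh : 0 ≤ h) (hV : VCross 0 w 0 h S) {z : Site}
    (hz : z ∈ rect 0 w 0 h) (hzO : z ∉ leftRegion w h S)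
    (hadj : z.1 = 0 ∨ ∃ o ∈ leftRegion w h S, Brick z o) :
    ∃ u, u.2 = h ∧ Linked Brick (S ∩ rect 0 w 0 h) u z := by
  have hzU : z ∈ explored w h S := by
    by_contra hU
    rcases hadj with h0 | ⟨o, ⟨u, hu, huo⟩, ho⟩
    · exact hzO ⟨z, h0, .refl ⟨hz, hU⟩⟩
    · exact hzO ⟨u, hu, huo.tail ho.symm ⟨hz, hU⟩⟩
  have hzC : z ∉ rightCluster w h S := by
    intro hC
    rcases hadj with h0 | ⟨o, ho, hzo⟩
    · exact ne_zero_of_mem_rightCluster hV hC h0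
    · exact (leftRegion_subset ho).2 (mem_explored_of_adj hC hzo (leftRegion_subset ho).1)
  have hzF : z ∈ frontLine w h S := hzU.resolve_left hzC
  obtain ⟨p, q, hp, hq, hpq⟩ := exists_linked_frontLine hw hh hV
  set B : Set Site := insert z (rightCluster w h S ∪ leftRegion w h S) with hB
  have hzB : z ∈ B := Set.mem_insert _ _
  have hBR : B ⊆ rect 0 w 0 h := by
    rintro y (rfl | hy | hy)
    exacts [hz, (rightCluster_subset hy).1, (leftRegion_subset hy).1]
  have hright : ∃ v, v.1 = w ∧ Linked Brick B z v := by
    rcases hzF.2 with hzw | ⟨c, ⟨v, hv, hvc⟩, hcz⟩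
    · exact ⟨z, hzw, .refl hzB⟩
    · refine ⟨v, hv, (((hvc.linked.mono ?_).tail hcz hzB)).brick_symm⟩
      exact fun y hy => Or.inr (Or.inl ⟨v, hv, hy⟩)
  have hleft : ∃ u, u.1 = 0 ∧ Linked Brick B u z := by
    rcases hadj with h0 | ⟨o, ⟨u, hu, huo⟩, ho⟩
    · exact ⟨z, h0, .refl hzB⟩
    · refine ⟨u, hu, (huo.linked.mono ?_).tail ho.symm hzB⟩
      exact fun y hy => Or.inr (Or.inr ⟨u, hu, hy⟩)
  obtain ⟨v, hv, hzv⟩ := hright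
  obtain ⟨u, hu, huz⟩ := hleft
  have h1 : HCross 0 w 0 h B :=
    ⟨u, v, hu, hv, (huz.trans hzv).mono fun y hy => ⟨hy, hBR hy⟩⟩
  have h2 : VCross 0 w 0 h {y | Linked Brick (frontLine w h S) p y} :=
    ⟨p, q, hp, hq, hpq.linked.mono fun y hy => ⟨hy, (frontLine_subset hy.right).2⟩⟩
  obtain ⟨y, ⟨hyB, hpy⟩, -⟩ := h1.inter_nonempty h2
  have hyF := hpy.right
  have hyz : y = z := by
    rcases hyB with hy | hy | hy
    · exact hy
    · exact absurd (frontLine_subset hyF).1 (rightCluster_subset hy).2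
    · exact absurd (Or.inr hyF) (leftRegion_subset hy).2
  subst hyz
  exact ⟨q, hq, (hpq.brick_symm.trans hpy).mono frontLine_subset⟩

/-- The exploration from the right only inspects the sites that it explores, so changing the
configuration elsewhere does not affect it. -/
lemma explored_congr {S' : Set Site} (hS : ∀ z ∈ explored w h S, z ∈ S ↔ z ∈ S') :
    rightCluster w h S' = rightCluster w h S ∧ frontLine w h S' = frontLine w h S := by
  have hC : rightCluster w h S' = rightCluster w h S := by
    apply Set.Subset.antisymm
    · rintro z ⟨u, hu, huz⟩
      have key : ∀ y ∈ explored w h S, y ∉ S' → y ∈ rightCluster w h S := fun y hy hyS =>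
        hy.resolve_right fun hF => hyS ((hS y hy).1 hF.1.1)
      refine huz.induct (key u (mem_explored_of_right huz.left.1 hu) huz.left.2) ?_
      intro a b _ hab hb ha
      exact key b (mem_explored_of_adj ha hab hb.1) hb.2
    · rintro z ⟨u, hu, huz⟩
      refine ⟨u, hu, huz.linked.mono fun y hy => ⟨hy.right.1, fun hyS => hy.right.2 ?_⟩⟩
      exact (hS y (Or.inl ⟨u, hu, hy⟩)).2 hyS
  refine ⟨hC, Set.ext fun z => ?_⟩
  have hmem : z ∈ rect 0 w 0 h → (z.1 = w ∨ ∃ c ∈ rightCluster w h S, Brick c z) →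
      z ∈ explored w h S := by
    rintro hz (h1 | ⟨c, hc, h1⟩)
    exacts [mem_explored_of_right hz h1, mem_explored_of_adj hc h1 hz]
  simp only [frontLine, hC, Set.mem_ofPred_eq, Set.mem_inter_iff]
  constructor
  · rintro ⟨⟨h1, h2⟩, h3⟩
    exact ⟨⟨(hS z (hmem h2 h3)).2 h1, h2⟩, h3⟩
  · rintro ⟨⟨h1, h2⟩, h3⟩
    exact ⟨⟨(hS z (hmem h2 h3)).1 h1, h2⟩, h3⟩

lemma notMem_symRegion_of_explored {z : Site} (hz : z ∈ explored w h S) :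
    z ∉ symRegion w h S := by
  rintro (h1 | h1)
  · exact (leftRegion_subset h1).2 hz
  · have h2 := (leftRegion_subset h1).1.2.1
    have h3 := (explored_subset hz).2.1
    rw [reflect_eq (by simp at h2; omega)] at h1
    exact (leftRegion_subset h1).2 hz

lemma symRegion_subset (hh : 0 ≤ h) : symRegion w h S ⊆ rect 0 w (-h) h := by
  rintro z (hz | hz)
  · obtain ⟨h1, h2⟩ := (leftRegion_subset hz).1
    exact ⟨h1, by omega⟩
  · obtain ⟨h1, h2⟩ := (leftRegion_subset hz).1
    exact ⟨h1, by simp at h2; omega⟩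

lemma reflect_mem_symRegion {z : Site} :
    reflect z ∈ symRegion w h S ↔ z ∈ symRegion w h S := by
  simp [symRegion, or_comm]

lemma mem_swap {z : Site} : z ∈ swap w h S ↔
    (z ∈ S ∧ z ∉ symRegion w h S) ∨ (z ∈ symRegion w h S ∧ reflect z ∉ S) := Iff.rfl

lemma mem_swap_iff_of_explored {z : Site} (hz : z ∈ explored w h S) :
    z ∈ S ↔ z ∈ swap w h S := by
  simp [swap, notMem_symRegion_of_explored hz]

lemma explored_swap : explored w h (swap w h S) = explored w h S := by
  obtain ⟨h1, h2⟩ := explored_congr (w := w) (h := h) fun z hz => mem_swap_iff_of_explored hz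
  rw [explored, h1, h2, explored]

lemma leftRegion_swap : leftRegion w h (swap w h S) = leftRegion w h S := by
  rw [leftRegion, explored_swap, leftRegion]

lemma symRegion_swap : symRegion w h (swap w h S) = symRegion w h S := by
  rw [symRegion, leftRegion_swap, symRegion]

/-- The explored set is disjoint from the symmetric region, so `swap` does not change the region in
which it acts, and there it is an involution. Injectivity is what makes it preserve probabilities at
density 1/2. -/
lemma swap_swap : swap w h (swap w h S) = S := by
  ext z
  have h1 := reflect_mem_symRegion (w := w) (h := h) (S := S) (z := z)
  simp only [mem_swap, symRegion_swap, reflect_reflect, h1]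
  tauto

lemma vCross_swap (hw : 0 ≤ w) (hh : 0 ≤ h) (hV : VCross 0 w 0 h S) :
    VCross 0 w 0 h (swap w h S) := by
  obtain ⟨u, v, hu, hv, huv⟩ := exists_linked_frontLine hw hh hV
  refine ⟨u, v, hu, hv, huv.mono fun z hz => ⟨?_, hz.1.2⟩⟩
  exact (mem_swap_iff_of_explored (Or.inr hz)).1 hz.1.1

variable (w h S) in
/-- Boundary conditions for the symmetric region. -/
def dobrushin : Set Site :=
  (rect 0 w 0 h \ leftRegion w h S) ∪ (symRegion w h S ∩ S) ∪
    {z | z.1 = w + 1 ∧ 0 ≤ z.2} ∪ {z | (z.1 = -1 ∧ z.2 ≤ 0) ∨ (z.2 = -h - 1 ∧ z.1 ≤ w)}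

/-- The path is followed backwards from the lower left boundary. While it stays in the symmetric
region it uses points of `S`; when it leaves, it does so at a point of the front line, from which
`S` continues to the top. It has to leave, since the symmetric region does not touch the right
column. -/
lemma topToLowerLeft_of_linked (hw : 0 < w) (hh : 0 < h) (hV : VCross 0 w 0 h S) {α β : Site}
    (hαβ : Linked Brick (dobrushin w h S) α β) (hα : α.1 = w + 1)
    (hβ : (β.1 = -1 ∧ β.2 ≤ 0) ∨ (β.2 = -h - 1 ∧ β.1 ≤ w)) : TopToLowerLeft w h S := by
  have hRB : rect 0 w 0 h ⊆ rect 0 w (-h) h := fun z hz => ⟨hz.1, by have := hz.2; omega⟩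
  have step : TopToLowerLeft w h S ∨ ((α.1 = -1 ∧ α.2 ≤ 0) ∨ (α.2 = -h - 1 ∧ α.1 ≤ w)) ∨
      (α ∈ symRegion w h S ∧ ∃ v : Site, (v.2 = -h ∨ (v.1 = 0 ∧ v.2 ≤ 0)) ∧
        Linked Brick (S ∩ rect 0 w (-h) h) α v) := by
    refine hαβ.induct_back
      (P := fun z => TopToLowerLeft w h S ∨ ((z.1 = -1 ∧ z.2 ≤ 0) ∨ (z.2 = -h - 1 ∧ z.1 ≤ w)) ∨
        (z ∈ symRegion w h S ∧ ∃ v : Site, (v.2 = -h ∨ (v.1 = 0 ∧ v.2 ≤ 0)) ∧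
        Linked Brick (S ∩ rect 0 w (-h) h) z v)) (Or.inr (Or.inl hβ)) ?_
    intro a b hab ha _ hb
    rcases hb with hb | hb
    · exact Or.inl hb
    rcases ha with ((ha | ⟨haD, haS⟩) | ha) | ha
    · left
      obtain ⟨haR, haO⟩ := ha
      have ha1 := haR.1
      have ha2 := haR.2
      rcases hb with hb | ⟨hbD, v, hv, hbv⟩
      · have h0 : a.1 = 0 ∧ a.2 ≤ 0 := by unfold Brick at hab; omega
        obtain ⟨u, hu, hua⟩ := linked_top_of_adj_leftRegion hw.le hh.le hV haR haO (Or.inl h0.1)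
        exact ⟨u, a, hu, Or.inr h0, hua.mono (Set.inter_subset_inter_right _ hRB)⟩
      · have hadj : ∃ o ∈ leftRegion w h S, Brick a o := by
          rcases hbD with hbO | hbO
          · exact ⟨b, hbO, hab⟩
          · have h1 := (leftRegion_subset hbO).1.2.1
            rw [reflect_snd] at h1
            by_cases hb0 : b.2 = 0
            · rw [reflect_eq hb0] at hbO
              exact ⟨b, hbO, hab⟩
            -- Here `b` is strictly below row zero and `a` is not, so `a` is on the axis of
            -- reflection and is also adjacent to the mirror image of `b`.
            · have ha0 : a.2 = 0 := by unfold Brick at hab; omega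
              exact ⟨reflect b, hbO, by simpa [reflect_eq ha0] using hab.reflect⟩
        obtain ⟨u, hu, hua⟩ := linked_top_of_adj_leftRegion hw.le hh.le hV haR haO (Or.inr hadj)
        refine ⟨u, v, hu, hv, ?_⟩
        exact ((hua.mono (Set.inter_subset_inter_right _ hRB)).tail hab hbv.left).trans hbv
    · right; right
      have haB := symRegion_subset hh.le haD
      refine ⟨haD, ?_⟩
      rcases hb with hb | ⟨hbD, v, hv, hbv⟩
      · refine ⟨a, ?_, .refl ⟨haS, haB⟩⟩
        have h1 := haB.1
        have h2 := haB.2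
        unfold Brick at hab; omega
      · exact ⟨v, hv, .head ⟨haS, haB⟩ hab hbv⟩
    · exfalso
      have ha1 : a.1 = w + 1 := ha.1
      have ha2 : 0 ≤ a.2 := ha.2
      rcases hb with hb | ⟨hbD, -⟩
      · unfold Brick at hab; omega
      · have hbB := (symRegion_subset hh.le hbD).1
        have hbw : b.1 = w := by unfold Brick at hab; omega
        rcases hbD with hbO | hbO
        · exact (leftRegion_subset hbO).2
            (mem_explored_of_right (leftRegion_subset hbO).1 hbw)
        · exact (leftRegion_subset hbO).2
            (mem_explored_of_right (leftRegion_subset hbO).1 hbw)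
    · exact Or.inr (Or.inl ha)
  rcases step with h1 | h1 | ⟨h1, -⟩
  · exact h1
  · omega
  · have := (symRegion_subset hh.le h1).1
    omega

/-- The boundary conditions are antisymmetric: reflecting and exchanging the colours turns the
complement of the set for `S` into part of the set for `swap w h S`. -/
lemma reflect_mem_dobrushin_swap {z : Site} (hz : z ∈ rect (-1) (w + 1) (-h - 1) (h + 1))
    (hzX : z ∉ dobrushin w h S) (hh : 0 < h) (hw : 0 < w) :
    reflect z ∈ dobrushin w h (swap w h S) := by
  simp only [dobrushin, Set.mem_union, Set.mem_sdiff, Set.mem_inter_iff, not_or, not_and,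
    leftRegion_swap, symRegion_swap, Set.mem_ofPred_eq, reflect_fst, reflect_snd,
    reflect_mem_symRegion, not_not] at hzX ⊢
  obtain ⟨⟨⟨h1, h2⟩, h3⟩, h4⟩ := hzX
  rw [mem_rect] at hz h1
  by_cases hB : z ∈ rect 0 w (-h) h
  · left; left
    by_cases hD : z ∈ symRegion w h S
    · right
      refine ⟨hD, Or.inr ⟨reflect_mem_symRegion.2 hD, ?_⟩⟩
      rw [reflect_reflect]
      exact h2 hD
    · left
      have hO : z ∉ leftRegion w h S := fun h => hD (Or.inl h)
      have hO' : reflect z ∉ leftRegion w h S := fun h => hD (Or.inr h)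
      refine ⟨?_, hO'⟩
      have h5 : ¬ ((0 ≤ z.1 ∧ z.1 ≤ w) ∧ 0 ≤ z.2 ∧ z.2 ≤ h) := fun h => hO (h1 h)
      rw [mem_rect] at hB ⊢
      simp only [reflect_fst, reflect_snd]
      omega
  · rw [mem_rect] at hB
    have : (z.1 = w + 1 ∧ 0 ≤ -z.2) ∨ ((z.1 = -1 ∧ -z.2 ≤ 0) ∨ (-z.2 = -h - 1 ∧ z.1 ≤ w)) := by
      clear h1 h2
      omega
    rcases this with h5 | h5
    exacts [Or.inl (Or.inr h5), Or.inr h5]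

/-- The Hex theorem in the rectangle enlarged by one layer gives a path for the boundary conditions
or a path in their complement; reflected, the latter is a path of the same kind for the swapped
configuration. -/
lemma topToLowerLeft_or_swap (hw : 0 < w) (hh : 0 < h) (hV : VCross 0 w 0 h S) :
    TopToLowerLeft w h S ∨ TopToLowerLeft w h (swap w h S) := by
  rcases isGrid_brick.hex (dobrushin w h S) (x₀ := -1) (x₁ := w + 1) (y₀ := -h - 1) (y₁ := h + 1)
    (by omega) (by omega) with ⟨u, v, hu, hv, huv⟩ | ⟨u, v, hu, hv, huv⟩
  · left
    refine topToLowerLeft_of_linked hw hh hV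
      (huv.brick_symm.mono Set.inter_subset_left) hv ?_
    rcases huv.left.1 with ((h1 | ⟨h1, -⟩) | h1) | h1
    · have := h1.1.1; omega
    · have := (symRegion_subset hh.le h1).1; omega
    · have : u.1 = w + 1 := h1.1
      omega
    · exact h1
  · right
    refine topToLowerLeft_of_linked hw hh (vCross_swap hw.le hh.le hV)
      (huv.map reflect (fun _ _ => Brick.reflect)
        fun a ha => reflect_mem_dobrushin_swap ha.1 ha.2 hh hw) ?_ ?_
    · have h1 := huv.left
      have h2 : ¬ ((u.1 = -1 ∧ u.2 ≤ 0) ∨ (u.2 = -h - 1 ∧ u.1 ≤ w)) := fun h => h1.2 (Or.inr h)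
      have h3 := h1.1.1
      simp only [reflect_fst]; omega
    · have h1 := huv.right
      have h2 : ¬ (v.1 = w + 1 ∧ 0 ≤ v.2) := fun h => h1.2 (Or.inl (Or.inr h))
      have h3 := h1.1.1
      simp only [reflect_fst, reflect_snd]; omega

end Explore

/-! ### Gluing a path to a mirrored one -/

lemma linked_row {A : Set Site} {x y : ℤ} (n : ℕ) (h : ∀ i : ℤ, 0 ≤ i → i ≤ n → (x + i, y) ∈ A) :
    Linked Brick A (x, y) (x + n, y) := by
  induction n with
  | zero => simpa using Linked.refl (by simpa using h 0 le_rfl le_rfl)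
  | succ n ih =>
    refine (ih fun i h0 hi => h i h0 (by push_cast; omega)).tail ?_ (h _ (by omega) le_rfl)
    simp [Brick, add_assoc]

lemma linked_col {A : Set Site} {x y : ℤ} (n : ℕ) (h : ∀ i : ℤ, 0 ≤ i → i ≤ n → (x, y + i) ∈ A) :
    Linked Brick A (x, y) (x, y + n) := by
  induction n with
  | zero => simpa using Linked.refl (by simpa using h 0 le_rfl le_rfl)
  | succ n ih =>
    refine (ih fun i h0 hi => h i h0 (by push_cast; omega)).tail ?_ (h _ (by omega) le_rfl)
    simp [Brick, add_assoc]

/-- One path goes from the top to the lower left, the mirrored one from the bottom to the upper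
left. Unless one of them already crosses, they must intersect, which is made rigorous by extending
them along an extra row at the top and an extra column at the left. -/
lemma vCross_of_topToLowerLeft {w h : ℤ} {S : Set Site} (h1 : TopToLowerLeft w h S)
    (h2 : TopToLowerLeft w h (reflect ⁻¹' S)) : VCross 0 w (-h) h S := by
  obtain ⟨u, v, hu, hv, huv⟩ := h1
  obtain ⟨p', q', hp', hq', hpq'⟩ := h2
  obtain ⟨p, q, hp, hq, hpq⟩ : ∃ p q : Site, p.2 = -h ∧ (q.2 = h ∨ (q.1 = 0 ∧ 0 ≤ q.2)) ∧
      Linked Brick (S ∩ rect 0 w (-h) h) p q := by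
    refine ⟨reflect p', reflect q', by simp [hp'], by simp; omega,
      hpq'.map reflect (fun _ _ => Brick.reflect) ?_⟩
    rintro a ⟨ha, ha1, ha2⟩
    exact ⟨ha, ha1, by simp only [reflect_snd]; omega⟩
  rcases hv with hv | hv
  · exact ⟨v, u, hv, hu, huv.brick_symm⟩
  rcases hq with hq | hq
  · exact ⟨p, q, hp, hq, hpq⟩
  have common : ∀ z, Linked Brick (S ∩ rect 0 w (-h) h) u z →
      Linked Brick (S ∩ rect 0 w (-h) h) p z → VCross 0 w (-h) h S := fun z h1 h2 =>
    ⟨p, u, hp, hu, h2.trans h1.brick_symm⟩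
  have hur := huv.left.2
  have hvr := huv.right.2
  have hqr := hpq.right.2
  rw [mem_rect] at hur hvr hqr
  set A : Set Site := {z | Linked Brick (S ∩ rect 0 w (-h) h) u z} ∪
    {z | z.2 = h + 1 ∧ 0 ≤ z.1 ∧ z.1 ≤ w} ∪ {(-1, v.2)} with hA
  set B : Set Site := {z | Linked Brick (S ∩ rect 0 w (-h) h) p z} ∪
    {z | z.1 = -1 ∧ q.2 ≤ z.2 ∧ z.2 ≤ h + 1} with hB
  have pathA : Linked Brick A (-1, v.2) (w, h + 1) := by
    have e1 : Linked Brick A v u := (huv.linked.mono fun z hz => Or.inl (Or.inl hz)).brick_symm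
    have e2 : Linked Brick A (-1, v.2) u :=
      .head (Or.inr rfl) (by unfold Brick; simp; omega) e1
    have e3 : Linked Brick A (-1, v.2) (u.1, h + 1) :=
      e2.tail (by unfold Brick; simp; omega) (Or.inl (Or.inr ⟨rfl, hur.1.1, hur.1.2⟩))
    have e4 := linked_row (A := A) (x := u.1) (y := h + 1) (w - u.1).toNat fun i h0 hi =>
      Or.inl (Or.inr ⟨rfl, by simp; omega, by simp; omega⟩)
    rw [show u.1 + ((w - u.1).toNat : ℤ) = w by omega] at e4
    exact e3.trans e4
  have pathB : Linked Brick B p (-1, h + 1) := by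
    have e1 : Linked Brick B p q := hpq.linked.mono fun z hz => Or.inl hz
    have e2 : Linked Brick B p (-1, q.2) :=
      e1.tail (by unfold Brick; simp; omega) (Or.inr ⟨rfl, le_rfl, by simp; omega⟩)
    have e4 := linked_col (A := B) (x := -1) (y := q.2) (h + 1 - q.2).toNat fun i h0 hi =>
      Or.inr ⟨rfl, by simp; omega, by simp; omega⟩
    rw [show q.2 + ((h + 1 - q.2).toNat : ℤ) = h + 1 by omega] at e4
    exact e2.trans e4
  have rowsA : ∀ z ∈ A, -h ≤ z.2 ∧ z.2 ≤ h + 1 := by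
    rintro z ((hz | hz) | rfl)
    · have := hz.right.2.2; omega
    · have : z.2 = h + 1 := hz.1
      omega
    · simp only; omega
  have colsB : ∀ z ∈ B, -1 ≤ z.1 ∧ z.1 ≤ w := by
    rintro z (hz | hz)
    · have := hz.right.2.1; omega
    · have : z.1 = -1 := hz.1
      omega
  obtain ⟨z, hzA, hzB⟩ := pathA.inter_nonempty pathB (fun z hz => (colsB z hz).1)
    (fun z hz => (colsB z hz).2) (fun z hz => hp ▸ (rowsA z hz).1) (fun z hz => (rowsA z hz).2)
  rcases hzB with hzB | ⟨hz1, hz2, hz3⟩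
  · rcases hzA with (hzA | ⟨hz1, -⟩) | rfl
    · exact common z hzA hzB
    · have := hzB.right.2.2.2; omega
    · have := hzB.right.2.1.1; simp at this
  · rcases hzA with (hzA | ⟨hz4, hz5, -⟩) | rfl
    · have := hzA.right.2.1.1; omega
    · omega
    -- The extensions can only meet when `v.2 ≤ 0 ≤ q.2 ≤ v.2`, that is, when both paths end at the
    -- origin.
    · have hqv : q = v := by
        simp only at hz2
        ext <;> omega
      exact common v huv (hqv ▸ hpq)

/-! ### Crossing probabilities at the self-dual point -/

lemma Increasing.unif_le_of_subset {α : Type*} [DecidableEq α] {A : Finset α → Prop}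
    (hA : Increasing A) {Λ Λ' : Finset α} (h : Λ ⊆ Λ') : unif Λ A ≤ unif Λ' A := by
  obtain ⟨Δ, rfl, hd⟩ : ∃ Δ, Λ' = Δ ∪ Λ ∧ Disjoint Δ Λ :=
    ⟨Λ' \ Λ, (Finset.sdiff_union_of_subset h).symm, Finset.sdiff_disjoint⟩
  clear h
  induction Δ using Finset.induction_on with
  | empty => simp
  | insert a Δ ha ih =>
    rw [Finset.disjoint_insert_left] at hd
    rw [Finset.insert_union, unif_insert (by simp [ha, hd.1])]
    linarith [ih hd.2, hA.unif_le a (Δ ∪ Λ)]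

/-- The rectangle as a finite set. -/
def rectFin (x₀ x₁ y₀ y₁ : ℤ) : Finset Site := Finset.Icc x₀ x₁ ×ˢ Finset.Icc y₀ y₁

lemma mem_rectFin {x₀ x₁ y₀ y₁ : ℤ} {z : Site} :
    z ∈ rectFin x₀ x₁ y₀ y₁ ↔ (x₀ ≤ z.1 ∧ z.1 ≤ x₁) ∧ y₀ ≤ z.2 ∧ z.2 ≤ y₁ := by
  simp [rectFin]

@[simp] lemma coe_rectFin (x₀ x₁ y₀ y₁ : ℤ) :
    (rectFin x₀ x₁ y₀ y₁ : Set Site) = rect x₀ x₁ y₀ y₁ := by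
  ext z; exact mem_rectFin

lemma increasing_vCross (x₀ x₁ y₀ y₁ : ℤ) :
    Increasing (fun S : Finset Site => VCross x₀ x₁ y₀ y₁ S) := fun _ _ h =>
  VCross.mono fun _ hz => h hz.1

lemma increasing_hCross (x₀ x₁ y₀ y₁ : ℤ) :
    Increasing (fun S : Finset Site => HCross x₀ x₁ y₀ y₁ S) := fun _ _ h =>
  HCross.mono fun _ hz => h hz.1

/-- The probability of a vertical crossing. -/
def vProb (x₀ x₁ y₀ y₁ : ℤ) : ℝ :=
  unif (rectFin x₀ x₁ y₀ y₁) (fun S => VCross x₀ x₁ y₀ y₁ S)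

/-- The reflection as a permutation of the sites. -/
def reflectEquiv : Site ≃ Site := ⟨reflect, reflect, reflect_reflect, reflect_reflect⟩

/-- Since `swap` is injective, `TopToLowerLeft` has at least half the probability of the vertical
crossing. The Harris inequality for this event and its mirror image squares that half. -/
lemma sq_vProb_div_four_le {w h : ℤ} (hw : 0 < w) (hh : 0 < h) :
    vProb 0 w 0 h ^ 2 / 4 ≤ vProb 0 w (-h) h := by
  classical
  set Λ := rectFin 0 w (-h) h with hΛ
  set V : Finset Site → Prop := fun S => VCross 0 w 0 h S with hV
  set M : Finset Site → Prop := fun S => TopToLowerLeft w h S with hM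
  have hΛB : ∀ z, z ∈ Λ ↔ z ∈ rect 0 w (-h) h := fun z => mem_rectFin
  have hVΛ : vProb 0 w 0 h = unif Λ V := by
    refine (unif_eq_of_subset (fun z hz => ?_) fun S => ?_).symm
    · rw [mem_rectFin] at *
      exact ⟨hz.1, by omega⟩
    · constructor
      · refine VCross.mono fun z hz => ?_
        simp only [Finset.coe_inter, coe_rectFin]
        exact hz
      · exact VCross.mono fun z hz => (Finset.mem_inter.1 hz.1).1
  have hVM : unif Λ V ≤ 2 * unif Λ M := by
    set f : Finset Site → Finset Site := fun S => Λ.filter (· ∈ swap w h S) with hf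
    have hfS : ∀ S ⊆ Λ, (f S : Set Site) = swap w h S := by
      intro S hS
      ext z
      simp only [hf, Finset.coe_filter, Set.mem_ofPred_eq, and_iff_right_iff_imp]
      rintro (⟨hz, -⟩ | ⟨hz, -⟩)
      · exact hS hz
      · exact (hΛB z).2 (symRegion_subset hh.le hz)
    have h1 : unif Λ V ≤ unif Λ (fun S => M S ∨ (V S ∧ M (f S))) := by
      refine unif_mono fun S hS hVS => ?_
      rcases topToLowerLeft_or_swap hw hh hVS with h1 | h1
      · exact Or.inl h1
      · refine Or.inr ⟨hVS, ?_⟩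
        simp only [hM, hfS S hS]
        exact h1
    have h2 : unif Λ (fun S => V S ∧ M (f S)) ≤ unif Λ M := by
      refine unif_le_of_injOn f (fun S _ hS => ⟨Finset.filter_subset _ _, hS.2⟩) ?_
      intro S hS T hT _ _ hST
      rw [← Finset.coe_inj, hfS S hS, hfS T hT] at hST
      rw [← Finset.coe_inj, ← swap_swap (w := w) (h := h) (S := S), hST, swap_swap]
    linarith [unif_or_le Λ M fun S => V S ∧ M (f S)]
  have hMinc : Increasing M := by
    rintro S T hST ⟨u, v, hu, hv, huv⟩
    exact ⟨u, v, hu, hv, huv.mono fun z hz => ⟨hST hz.1, hz.2⟩⟩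
  set M' : Finset Site → Prop := fun S => M (S.map reflectEquiv.toEmbedding) with hM'
  have hM'inc : Increasing M' := fun S T hST => hMinc _ _ (Finset.map_subset_map.2 hST)
  have hmap : Λ.map reflectEquiv.toEmbedding = Λ := by
    ext z
    rw [Finset.mem_map_equiv]
    change reflect z ∈ Λ ↔ z ∈ Λ
    simp only [hΛ, mem_rectFin, reflect_fst, reflect_snd]
    omega
  have hMM' : unif Λ M' = unif Λ M := by
    rw [hM', ← unif_map, hmap]
  have hfin : unif Λ (fun S => M S ∧ M' S) ≤ vProb 0 w (-h) h := by
    refine unif_mono fun S _ hS => vCross_of_topToLowerLeft hS.1 ?_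
    have : ((S.map reflectEquiv.toEmbedding : Finset Site) : Set Site) = reflect ⁻¹' S := by
      ext z
      rw [Finset.mem_coe, Finset.mem_map_equiv]
      rfl
    simpa only [hM', hM, this] using hS.2
  have hFKG := hMinc.unif_mul_le_unif_and hM'inc Λ
  rw [hMM'] at hFKG
  rw [hVΛ]
  have h0 := unif_nonneg Λ V
  nlinarith

/-- Translations of the lattice. -/
def shift (s t : ℤ) : Site ≃ Site := Equiv.addRight (s, t)

/-- An odd vertical translation would exchange the two kinds of rows. -/
lemma Brick.shift {u v : Site} (h : Brick u v) (s : ℤ) {t : ℤ} (ht : Even t) :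
    Brick (shift s t u) (shift s t v) := by
  obtain ⟨k, rfl⟩ := ht
  unfold Brick at *
  simp only [TriPerc.shift, Equiv.coe_addRight, Prod.fst_add, Prod.snd_add]
  omega

lemma vProb_shift (x₀ x₁ y₀ y₁ s : ℤ) {t : ℤ} (ht : Even t) :
    vProb x₀ x₁ y₀ y₁ ≤ vProb (x₀ + s) (x₁ + s) (y₀ + t) (y₁ + t) := by
  have hmap : (rectFin x₀ x₁ y₀ y₁).map (shift s t).toEmbedding =
      rectFin (x₀ + s) (x₁ + s) (y₀ + t) (y₁ + t) := by
    ext z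
    rw [Finset.mem_map_equiv]
    simp [mem_rectFin, shift]
  rw [vProb, vProb, ← hmap, unif_map]
  refine unif_mono fun S _ => ?_
  rintro ⟨u, v, hu, hv, huv⟩
  refine ⟨shift s t u, shift s t v, by simp [shift, hu], by simp [shift, hv],
    huv.map _ (fun _ _ h => h.shift s ht) ?_⟩
  rintro z ⟨hz, hzr⟩
  refine ⟨by simpa using hz, ?_⟩
  rw [mem_rect] at *
  simp [shift]
  omega

lemma sq_vProb_div_four_le_two_mul {w h : ℤ} (hw : 0 < w) (hh : 0 < h) (he : Even h) :
    vProb 0 w 0 h ^ 2 / 4 ≤ vProb 0 w 0 (2 * h) := by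
  refine (sq_vProb_div_four_le hw hh).trans ?_
  have := vProb_shift 0 w (-h) h 0 he
  simpa [two_mul] using this

/-! ### The rhombus -/

lemma adj_iff {u v : Site} : Adj u v ↔
    (v.1 = u.1 + 1 ∧ v.2 = u.2) ∨ (u.1 = v.1 + 1 ∧ v.2 = u.2) ∨ (v.1 = u.1 ∧ v.2 = u.2 + 1) ∨
    (v.1 = u.1 ∧ u.2 = v.2 + 1) ∨ (v.1 = u.1 + 1 ∧ u.2 = v.2 + 1) ∨
    (u.1 = v.1 + 1 ∧ v.2 = u.2 + 1) := by
  simp only [Adj, Set.mem_insert_iff, Set.mem_singleton_iff, Prod.ext_iff, Prod.fst_sub,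
    Prod.snd_sub]
  omega

lemma Adj.symm {u v : Site} (h : Adj u v) : Adj v u := by
  rw [adj_iff] at *; omega

lemma isGrid_adj : IsGrid Adj where
  symm _ _ := Adj.symm
  horiz x y := by simp [adj_iff]
  vert x y := by simp [adj_iff]
  diag x y := by simp [adj_iff]

/-- The change to brick coordinates. -/
def toBrick : Site ≃ Site where
  toFun z := (z.1 + z.2 / 2, z.2)
  invFun z := (z.1 - z.2 / 2, z.2)
  left_inv z := by simp
  right_inv z := by simp

lemma Adj.toBrick {u v : Site} (h : Adj u v) : Brick (toBrick u) (toBrick v) := by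
  rw [adj_iff] at h
  unfold Brick
  simp only [TriPerc.toBrick, Equiv.coe_fn_mk]
  omega

/-- In lattice coordinates the rhombus is symmetric under exchange of the axes, so by the Hex
theorem and colour symmetry it is crossed with probability at least 1/2. In brick coordinates it is
sheared by half its height and fits into width `6 * n`. -/
lemma half_le_vProb (n : ℕ) : 1 / 2 ≤ vProb 0 (6 * n) 0 (4 * n) := by
  set Λ := rectFin 0 (4 * n) 0 (4 * n) with hΛ
  set V : Finset Site → Prop := fun S =>
    ∃ u v : Site, u.2 = 0 ∧ v.2 = 4 * n ∧ Linked Adj (S ∩ rect 0 (4 * n) 0 (4 * n)) u v with hV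
  set H : Finset Site → Prop := fun S =>
    ∃ u v : Site, u.1 = 0 ∧ v.1 = 4 * n ∧ Linked Adj (S ∩ rect 0 (4 * n) 0 (4 * n)) u v with hH
  have hmap : Λ.map (Equiv.prodComm ℤ ℤ).toEmbedding = Λ := by
    ext z
    rw [Finset.mem_map_equiv]
    simp only [hΛ, mem_rectFin, Equiv.prodComm_symm, Equiv.prodComm_apply, Prod.fst_swap,
      Prod.snd_swap]
    tauto
  have hHV : unif Λ H ≤ unif Λ V := by
    rw [← hmap, unif_map, hmap]
    refine unif_mono fun S _ => ?_
    rintro ⟨u, v, hu, hv, huv⟩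
    refine ⟨u.swap, v.swap, hu, hv, huv.map Prod.swap ?_ ?_⟩
    · intro a b hab
      rw [adj_iff] at *
      simp only [Prod.fst_swap, Prod.snd_swap]
      omega
    · rintro z ⟨hz, hzr⟩
      rw [Finset.mem_coe, Finset.mem_map_equiv] at hz
      exact ⟨hz, hzr.2, hzr.1⟩
  have hor : 1 ≤ unif Λ H + unif Λ V := by
    rw [← unif_compl Λ V, ← unif_true Λ]
    refine (unif_mono fun S hS _ => ?_).trans (unif_or_le _ _ _)
    rcases isGrid_adj.hex (S : Set Site) (x₀ := 0) (x₁ := 4 * n) (y₀ := 0) (y₁ := 4 * n)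
      (by omega) (by omega) with h | ⟨u, v, hu, hv, huv⟩
    · exact Or.inl h
    · refine Or.inr ⟨u, v, hu, hv, huv.mono fun z hz => ⟨?_, hz.1⟩⟩
      rw [Finset.mem_coe, Finset.mem_sdiff]
      exact ⟨mem_rectFin.2 hz.1, hz.2⟩
  have hVv : unif Λ V ≤ vProb 0 (6 * n) 0 (4 * n) := by
    have hsub : Λ.map toBrick.toEmbedding ⊆ rectFin 0 (6 * n) 0 (4 * n) := by
      intro z
      rw [Finset.mem_map_equiv]
      simp only [hΛ, mem_rectFin, toBrick, Equiv.coe_fn_symm_mk]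
      omega
    refine le_trans ?_ ((increasing_vCross 0 (6 * n) 0 (4 * n)).unif_le_of_subset hsub)
    rw [unif_map]
    refine unif_mono fun S hS => ?_
    rintro ⟨u, v, hu, hv, huv⟩
    refine ⟨toBrick u, toBrick v, hu, hv, huv.map _ (fun _ _ => Adj.toBrick) ?_⟩
    rintro z ⟨hz, hzr⟩
    have : toBrick z ∈ S.map toBrick.toEmbedding := Finset.mem_map_of_mem _ hz
    exact ⟨this, mem_rectFin.1 (hsub (Finset.map_subset_map.2 hS this))⟩
  linarith

/-- Short crossings of long rectangles have probability bounded away from one. -/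
theorem unif_hCross_le {n : ℕ} (hn : 0 < n) :
    unif (rectFin (6 * n) (12 * n) (-(32 * n)) (32 * n))
      (fun S => HCross (6 * n) (12 * n) (-(32 * n)) (32 * n) S) ≤ 1 - (1 / 2) ^ 46 := by
  have d : ∀ (h : ℤ) (c : ℝ), 0 < h → Even h → 0 ≤ c → c ≤ vProb 0 (6 * n) 0 h →
      c ^ 2 / 4 ≤ vProb 0 (6 * n) 0 (2 * h) := by
    intro h c hh he hc hcv
    refine le_trans ?_ (sq_vProb_div_four_le_two_mul (by omega) hh he)
    gcongr
  have ev : ∀ m : ℤ, Even m → Even (m * n) := fun m hm => hm.mul_right _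
  -- Four doublings take the height from `4 * n` to `64 * n` and the bound from `2 ^ (-1)` through
  -- `2 ^ (-4)`, `2 ^ (-10)` and `2 ^ (-22)` to `2 ^ (-46)`.
  have e1 := d (4 * n) (1 / 2) (by omega) (ev 4 (by decide)) (by norm_num) (half_le_vProb n)
  rw [← mul_assoc] at e1
  have e2 := d _ _ (by omega) (ev _ (by decide)) (by norm_num) e1
  rw [← mul_assoc] at e2
  have e3 := d _ _ (by omega) (ev _ (by decide)) (by norm_num) e2
  rw [← mul_assoc] at e3
  have e4 := d _ _ (by omega) (ev _ (by decide)) (by norm_num) e3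
  rw [← mul_assoc] at e4
  have e5 := e4.trans (vProb_shift 0 (6 * n) 0 _ (6 * n) (ev (-32) (by decide)))
  have e6 : (1 / 2 : ℝ) ^ 46 ≤ vProb (6 * n) (12 * n) (-(32 * n)) (32 * n) := by
    refine le_of_eq_of_le (by norm_num) (e5.trans_eq ?_)
    congr 1 <;> ring
  set Λ := rectFin (6 * n) (12 * n) (-(32 * n)) (32 * n) with hΛ
  have e7 : unif Λ (fun S => HCross (6 * n) (12 * n) (-(32 * n)) (32 * n) S) ≤
      unif Λ (fun S => ¬ VCross (6 * n) (12 * n) (-(32 * n)) (32 * n) (Λ \ S : Finset Site)) := by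
    refine unif_mono fun S _ hH hV => ?_
    obtain ⟨z, ⟨h1, h2⟩, -⟩ := hH.inter_nonempty hV
    exact (Finset.mem_sdiff.1 (Finset.mem_coe.1 h2)).2 h1
  rw [unif_not Λ (fun S => VCross (6 * n) (12 * n) (-(32 * n)) (32 * n) (Λ \ S : Finset Site)),
    unif_compl Λ (fun S => VCross (6 * n) (12 * n) (-(32 * n)) (32 * n) S)] at e7
  exact e7.trans (sub_le_sub_left e6 1)

/-! ### Disjoint crossings -/

/-- Many crossings of a rectangle, with a bound on the number of crossings through each point,
contain many disjoint crossings: the level sets of the distance from the bottom. -/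
theorem exists_disjoint_hCross {ι : Type*} {x₀ x₁ y₀ y₁ : ℤ} (hx : x₀ ≤ x₁) (hy : y₀ ≤ y₁)
    (S : Finset Site) (I : Finset ι) (T : ι → Set Site) (hTS : ∀ i ∈ I, ∀ z ∈ T i, z ∈ S)
    (hT : ∀ i ∈ I, HCross x₀ x₁ y₀ y₁ (T i)) {b m : ℕ}
    (hb : ∀ z : Site, ∀ J ⊆ I, (∀ i ∈ J, z ∈ T i) → J.card ≤ b) (hm : 0 < b) (hbm : b * m ≤ I.card) :
    ∃ W : ℕ → Finset Site, (∀ j < m, W j ⊆ S ∧ HCross x₀ x₁ y₀ y₁ (W j)) ∧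
      ∀ i j, i < j → j < m → Disjoint (W i) (W j) := by
  classical
  set Q := rect x₀ x₁ y₀ y₁ with hQ
  -- `reach j v` says that `v` can be reached from the bottom using at most `j` points of `S`. The
  -- disjoint crossings are found in the sets of points of `S` at distance exactly `j + 1`.
  set reach : ℕ → Site → Prop := fun j v => ∃ Z ⊆ S, Z.card ≤ j ∧
    ∃ u, u.2 = y₀ ∧ Linked Brick ({z | z ∈ S → z ∈ Z} ∩ Q) u v with hreach
  have rmono : ∀ {i j v}, i ≤ j → reach i v → reach j v := by
    rintro i j v hij ⟨Z, hZ, hc, h⟩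
    exact ⟨Z, hZ, hc.trans hij, h⟩
  have start : ∀ v ∈ Q, v.2 = y₀ → reach (if v ∈ S then 1 else 0) v := by
    intro v hv h0
    by_cases hS : v ∈ S
    · rw [if_pos hS]
      exact ⟨{v}, by simpa using hS, by simp, v, h0, .refl ⟨fun _ => by simp, hv⟩⟩
    · rw [if_neg hS]
      exact ⟨∅, by simp, by simp, v, h0, .refl ⟨fun h => absurd h hS, hv⟩⟩
  have next : ∀ j u v, reach j u → Brick u v → v ∈ Q →
      reach (j + if v ∈ S then 1 else 0) v := by
    rintro j u v ⟨Z, hZ, hc, p, hp, hpu⟩ huv hv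
    by_cases hS : v ∈ S
    · rw [if_pos hS]
      refine ⟨insert v Z, Finset.insert_subset hS hZ,
        (Finset.card_insert_le _ _).trans (by omega), p, hp, ?_⟩
      refine (hpu.mono ?_).tail huv ⟨fun _ => Finset.mem_insert_self _ _, hv⟩
      exact fun z hz => ⟨fun h => Finset.mem_insert_of_mem (hz.1 h), hz.2⟩
    · rw [if_neg hS]
      exact ⟨Z, hZ, hc, p, hp, hpu.tail huv ⟨fun h => absurd h hS, hv⟩⟩
  refine ⟨fun j => S.filter fun v => reach (j + 1) v ∧ ¬ reach j v, fun j hj =>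
    ⟨Finset.filter_subset _ _, ?_⟩, ?_⟩
  · set W : Set Site := ((S.filter fun v => reach (j + 1) v ∧ ¬ reach j v : Finset Site) : Set Site)
      with hW
    have hWmem : ∀ v, v ∉ W → v ∈ S → reach (j + 1) v → reach j v := by
      intro v hv hS hr
      by_contra hn
      exact hv (by simpa [hW] using ⟨hS, hr, hn⟩)
    rcases isGrid_brick.hex W hx hy with h | ⟨u, v, hu, hv, huv⟩
    · exact h
    · exfalso
      have hall : reach j v := by
        refine huv.induct ?_ ?_
        · have h1 := start u huv.left.1 hu
          by_cases hS : u ∈ S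
          · rw [if_pos hS] at h1
            exact hWmem u huv.left.2 hS (rmono (by omega) h1)
          · rw [if_neg hS] at h1
            exact rmono (by omega) h1
        · intro a c _ hac hc ha
          have h1 := next j a c ha hac hc.1
          by_cases hS : c ∈ S
          · rw [if_pos hS] at h1
            exact hWmem c hc.2 hS h1
          · rwa [if_neg hS] at h1
      -- A vertical path avoiding the level set never gets beyond distance `j`, so some vertical
      -- crossing uses only `j` points of `S`. Each `T i` passes through one of them, so there are
      -- at most `j * b < m * b` indices.
      obtain ⟨Z, hZ, hc, p, hp, hpv⟩ := hall
      have hVZ : VCross x₀ x₁ y₀ y₁ {z | z ∈ S → z ∈ Z} := ⟨p, v, hp, hv, hpv⟩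
      have hIZ : I ⊆ Z.biUnion fun z => I.filter fun i => z ∈ T i := by
        intro i hi
        obtain ⟨z, ⟨hz1, hz2⟩, -⟩ := (hT i hi).inter_nonempty hVZ
        rw [Finset.mem_biUnion]
        exact ⟨z, hz2 (hTS i hi z hz1), Finset.mem_filter.2 ⟨hi, hz1⟩⟩
      have h1 := Finset.card_le_card hIZ
      have h2 : (Z.biUnion fun z => I.filter fun i => z ∈ T i).card ≤ Z.card * b :=
        Finset.card_biUnion_le_card_mul _ _ _ fun z _ =>
          hb z _ (Finset.filter_subset _ _) fun i hi => (Finset.mem_filter.1 hi).2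
      nlinarith
  · intro i j hij _
    rw [Finset.disjoint_left]
    intro z h1 h2
    exact (Finset.mem_filter.1 h2).2.2 (rmono hij (Finset.mem_filter.1 h1).2.1)

/-! ### Triangular annuli -/

/-- Rotation of the triangular lattice by `2π/3`. -/
def rot : Site ≃ Site where
  toFun z := (-z.1 - z.2, z.1)
  invFun z := (z.2, -z.1 - z.2)
  left_inv z := by ext <;> simp
  right_inv z := Prod.ext (by dsimp only; ring) rfl

/-- Brick coordinates centred at `c` and rotated by `2π/3`, `4π/3` or not at all. -/
def chart (c : Site) (l : Fin 3) : Site ≃ Site :=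
  (Equiv.subRight c).trans ((![Equiv.refl _, rot, rot.symm] l).trans toBrick)

/-- Up to rounding the first coordinates of the three charts add up to zero, so upper bounds on all
three cut out a triangle. -/
lemma chart_zero (c z : Site) :
    chart c 0 z = ((z.1 - c.1) + (z.2 - c.2) / 2, z.2 - c.2) := rfl

lemma chart_one (c z : Site) : chart c 1 z =
    ((-(z.1 - c.1) - (z.2 - c.2)) + (z.1 - c.1) / 2, z.1 - c.1) := rfl

lemma chart_two (c z : Site) : chart c 2 z =
    ((z.2 - c.2) + (-(z.1 - c.1) - (z.2 - c.2)) / 2, -(z.1 - c.1) - (z.2 - c.2)) := rfl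

lemma Adj.chart {u v : Site} (h : Adj u v) (c : Site) (l : Fin 3) :
    Brick (chart c l u) (chart c l v) := by
  rw [adj_iff] at h
  fin_cases l
  · change Brick (TriPerc.chart c 0 u) (TriPerc.chart c 0 v)
    rw [chart_zero, chart_zero]; unfold Brick; simp only; omega
  · change Brick (TriPerc.chart c 1 u) (TriPerc.chart c 1 v)
    rw [chart_one, chart_one]; unfold Brick; simp only; omega
  · change Brick (TriPerc.chart c 2 u) (TriPerc.chart c 2 v)
    rw [chart_two, chart_two]; unfold Brick; simp only; omega

/-- The set `S` crosses one of the sides of the triangular annulus of size `n` around `c`. -/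
def SideCross (c : Site) (n : ℕ) (l : Fin 3) (S : Set Site) : Prop :=
  HCross (6 * n) (12 * n) (-(32 * n)) (32 * n) (chart c l '' S)

/-- Stop the path when a first coordinate reaches `12 * n` and follow that chart back to the last
time it was below `6 * n`. Meanwhile the other two first coordinates are at most `12 * n`, which
keeps the second coordinate within `32 * n`. -/
lemma exists_sideCross {c : Site} {n : ℕ} (hn : 0 < n) {T : Set Site} {u v : Site}
    (huv : Linked Adj T u v) (hu : ∀ l, (chart c l u).1 < 6 * n)
    (hv : ∃ l, 12 * n ≤ (chart c l v).1) : ∃ l, SideCross c n l T := by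
  have key : (∃ l, SideCross c n l T) ∨ ∀ l, (chart c l v).1 < 12 * n ∧
      (6 * n ≤ (chart c l v).1 → ∃ p : Site, p.1 = 6 * n ∧
        Linked Brick (chart c l '' T ∩ rect (6 * n) (12 * n) (-(32 * n)) (32 * n)) p
          (chart c l v)) := by
    refine huv.induct ?_ ?_
    · right
      intro l
      have := hu l
      exact ⟨by omega, fun h => by omega⟩
    · intro a b _ hab hb ha
      rcases ha with ha | ha
      · exact Or.inl ha
      have hle : ∀ l, (chart c l b).1 ≤ 12 * n := by
        intro l
        have h1 := (ha l).1
        have h2 := hab.chart c l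
        unfold Brick at h2; omega
      have hrect : ∀ l, 6 * n ≤ (chart c l b).1 →
          chart c l b ∈ chart c l '' T ∩ rect (6 * n) (12 * n) (-(32 * n)) (32 * n) := by
        intro l hl
        refine ⟨Set.mem_image_of_mem _ hb, ⟨hl, hle l⟩, ?_⟩
        have h0 := hle 0
        have h1 := hle 1
        have h2 := hle 2
        rw [chart_zero] at h0
        rw [chart_one] at h1
        rw [chart_two] at h2
        simp only at h0 h1 h2
        fin_cases l
        · change _ ≤ (chart c 0 b).2 ∧ (chart c 0 b).2 ≤ _
          rw [chart_zero]; simp only; omega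
        · change _ ≤ (chart c 1 b).2 ∧ (chart c 1 b).2 ≤ _
          rw [chart_one]; simp only; omega
        · change _ ≤ (chart c 2 b).2 ∧ (chart c 2 b).2 ≤ _
          rw [chart_two]; simp only; omega
      have hlink : ∀ l, 6 * n ≤ (chart c l b).1 → ∃ p : Site, p.1 = 6 * n ∧
          Linked Brick (chart c l '' T ∩ rect (6 * n) (12 * n) (-(32 * n)) (32 * n)) p
            (chart c l b) := by
        intro l hl
        by_cases hal : 6 * n ≤ (chart c l a).1
        · obtain ⟨p, hp, hpa⟩ := (ha l).2 hal
          exact ⟨p, hp, hpa.tail (hab.chart c l) (hrect l hl)⟩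
        · refine ⟨chart c l b, ?_, .refl (hrect l hl)⟩
          have h2 := hab.chart c l
          unfold Brick at h2; omega
      by_cases hend : ∃ l, (chart c l b).1 = 12 * n
      · obtain ⟨l, hl⟩ := hend
        obtain ⟨p, hp, hpb⟩ := hlink l (by omega)
        exact Or.inl ⟨l, p, _, hp, hl, hpb⟩
      · push Not at hend
        exact Or.inr fun l => ⟨lt_of_le_of_ne (hle l) (hend l), hlink l⟩
  refine key.resolve_right fun h => ?_
  obtain ⟨l, hl⟩ := hv
  have := (h l).1
  omega

/-- The triangular annulus of size `n` around `c`. -/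
def triAnnulus (c : Site) (n : ℕ) : Set Site :=
  {z | (∃ l, 6 * n ≤ (chart c l z).1) ∧ ∀ l, (chart c l z).1 < 24 * n}

/-- At a point `(x, y)` of one chart the other first coordinates are, up to rounding, `-x / 2 ± 3 *
y / 4`, here at most `-3 * n + 24 * n = 21 * n`. -/
lemma mem_triAnnulus {c : Site} {n : ℕ} (hn : 0 < n) {l : Fin 3} {z : Site}
    (hz : chart c l z ∈ rect (6 * n) (12 * n) (-(32 * n)) (32 * n)) : z ∈ triAnnulus c n := by
  refine ⟨⟨l, hz.1.1⟩, ?_⟩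
  rw [mem_rect] at hz
  have key : (chart c 0 z).1 < 24 * n ∧ (chart c 1 z).1 < 24 * n ∧ (chart c 2 z).1 < 24 * n := by
    rw [chart_zero, chart_one, chart_two]
    fin_cases l
    · change (_ ≤ (chart c 0 z).1 ∧ (chart c 0 z).1 ≤ _) ∧
        _ ≤ (chart c 0 z).2 ∧ (chart c 0 z).2 ≤ _ at hz
      rw [chart_zero] at hz; simp only at hz ⊢; omega
    · change (_ ≤ (chart c 1 z).1 ∧ (chart c 1 z).1 ≤ _) ∧
        _ ≤ (chart c 1 z).2 ∧ (chart c 1 z).2 ≤ _ at hz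
      rw [chart_one] at hz; simp only at hz ⊢; omega
    · change (_ ≤ (chart c 2 z).1 ∧ (chart c 2 z).1 ≤ _) ∧
        _ ≤ (chart c 2 z).2 ∧ (chart c 2 z).2 ≤ _ at hz
      rw [chart_two] at hz; simp only at hz ⊢; omega
  intro l'
  fin_cases l'
  exacts [key.1, key.2.1, key.2.2]

lemma triAnnulus_subset (c : Site) (n : ℕ) :
    triAnnulus c n ⊆ rect (c.1 - 48 * n) (c.1 + 48 * n) (c.2 - 48 * n) (c.2 + 48 * n) := by
  rintro z ⟨-, hz⟩
  have h0 := hz 0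
  have h1 := hz 1
  have h2 := hz 2
  rw [chart_zero] at h0
  rw [chart_one] at h1
  rw [chart_two] at h2
  rw [mem_rect]
  simp only at h0 h1 h2
  omega

lemma disjoint_triAnnulus {c : Site} {n n' : ℕ} (h : 4 * n ≤ n') :
    Disjoint (triAnnulus c n) (triAnnulus c n') := by
  rw [Set.disjoint_left]
  rintro z ⟨-, h1⟩ ⟨⟨l, h2⟩, -⟩
  have := h1 l
  omega

/-- One of the sides of the triangular annulus of size `n` has `m` disjoint crossings. -/
def MultiCross (c : Site) (m n : ℕ) (S : Finset Site) : Prop :=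
  ∃ l, DisjOccs (fun _ (S : Finset Site) => SideCross c n l S) m S

lemma increasing_sideCross (c : Site) (n : ℕ) (l : Fin 3) :
    Increasing (fun S : Finset Site => SideCross c n l S) := fun _ _ h =>
  HCross.mono fun _ hz => Set.image_mono h hz.1

lemma increasing_multiCross (c : Site) (m n : ℕ) : Increasing (MultiCross c m n) := by
  rintro S T h ⟨l, hl⟩
  exact ⟨l, increasing_disjOccs _ _ _ _ h hl⟩

lemma unif_sideCross_le (c : Site) {n : ℕ} (hn : 0 < n) (l : Fin 3) (Λ : Finset Site) :
    unif Λ (fun S => SideCross c n l S) ≤ 1 - (1 / 2) ^ 46 := by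
  set A : Finset Site → Prop := fun S => HCross (6 * n) (12 * n) (-(32 * n)) (32 * n) S with hA
  set Q := rectFin (6 * n) (12 * n) (-(32 * n)) (32 * n) with hQ
  have e1 : unif Λ (fun S => SideCross c n l S) = unif (Λ.map (chart c l).toEmbedding) A := by
    rw [unif_map]
    refine unif_congr fun S _ => ?_
    simp only [SideCross, hA, Finset.coe_map]
    rfl
  have hAinc : Increasing A := increasing_hCross _ _ _ _
  rw [e1]
  -- `Λ` may contain only part of the rectangle: enlarge it by monotonicity, then drop the sites on
  -- which the event does not depend.
  refine (hAinc.unif_le_of_subset (Finset.subset_union_left (s₂ := Q))).trans ?_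
  refine (unif_eq_of_subset Finset.subset_union_right fun S => ⟨?_, ?_⟩).trans_le
    (unif_hCross_le hn)
  · refine HCross.mono fun z hz => ?_
    rw [Finset.coe_inter, hQ, coe_rectFin]
    exact hz
  · exact HCross.mono fun z hz => (Finset.mem_inter.1 hz.1).1

lemma unif_multiCross_le (c : Site) (m : ℕ) {n : ℕ} (hn : 0 < n) (Λ : Finset Site) :
    unif Λ (MultiCross c m n) ≤ 3 * (1 - (1 / 2) ^ 46) ^ m := by
  set A : Fin 3 → Finset Site → Prop := fun l =>
    DisjOccs (fun _ (S : Finset Site) => SideCross c n l S) m with hA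
  have h1 : ∀ l, unif Λ (A l) ≤ (1 - (1 / 2) ^ 46) ^ m := by
    intro l
    refine (unif_disjOccs_le (fun _ => increasing_sideCross c n l) Λ m).trans ?_
    rw [Finset.prod_const, Finset.card_range]
    exact pow_le_pow_left₀ (unif_nonneg _ _) (unif_sideCross_le c hn l Λ) m
  have h2 : unif Λ (MultiCross c m n) ≤ unif Λ (fun S => A 0 S ∨ (A 1 S ∨ A 2 S)) := by
    refine unif_mono fun S _ => ?_
    rintro ⟨l, hl⟩
    fin_cases l
    exacts [Or.inl hl, Or.inr (Or.inl hl), Or.inr (Or.inr hl)]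
  have h3 := unif_or_le Λ (A 0) (fun S => A 1 S ∨ A 2 S)
  have h4 := unif_or_le Λ (A 1) (A 2)
  linarith [h1 0, h1 1, h1 2]

/-- Crossings of disjoint triangular annuli at `N` successive scales. -/
def ScaleCross (c : Site) (m n N : ℕ) : Finset Site → Prop :=
  DisjOccs (fun i => MultiCross c m (4 ^ i * n)) N

lemma unif_scaleCross_le (c : Site) (m : ℕ) {n : ℕ} (hn : 0 < n) (N : ℕ) (Λ : Finset Site) :
    unif Λ (ScaleCross c m n N) ≤ (3 * (1 - (1 / 2) ^ 46) ^ m) ^ N := by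
  refine (unif_disjOccs_le (fun i => increasing_multiCross c m _) Λ N).trans ?_
  calc ∏ i ∈ Finset.range N, unif Λ (MultiCross c m (4 ^ i * n))
      ≤ ∏ _i ∈ Finset.range N, 3 * (1 - (1 / 2 : ℝ) ^ 46) ^ m :=
        Finset.prod_le_prod (fun _ _ => unif_nonneg _ _)
          fun i _ => unif_multiCross_le c m (by positivity) Λ
    _ = _ := by simp

/-- Many paths in `S` from the neighbourhood of `c` to far away, with a bound on the number of
paths through each point, produce many disjoint crossings at all scales in between. -/
theorem scaleCross_of_linked {ι : Type*} {c : Site} {m n N b : ℕ} (hn : 0 < n) (hb : 0 < b)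
    (I : Finset ι) (hI : 3 * (b * m) ≤ I.card) (T : ι → Set Site) (S : Finset Site)
    (hTS : ∀ i ∈ I, ∀ z ∈ T i, z ∈ rect (c.1 - 48 * (4 ^ N * n : ℕ)) (c.1 + 48 * (4 ^ N * n : ℕ))
      (c.2 - 48 * (4 ^ N * n : ℕ)) (c.2 + 48 * (4 ^ N * n : ℕ)) → z ∈ S)
    (hT : ∀ i ∈ I, ∃ u v, Linked Adj (T i) u v ∧ (∀ l, (chart c l u).1 < 6 * n) ∧
      ∃ l, 12 * (4 ^ N * n : ℕ) ≤ (chart c l v).1)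
    (hmult : ∀ z : Site, ∀ J ⊆ I, (∀ i ∈ J, z ∈ T i) → J.card ≤ b) :
    ScaleCross c m n N S := by
  classical
  set W : ℕ → Finset Site := fun i => S.filter (· ∈ triAnnulus c (4 ^ i * n)) with hW
  -- The witness at scale `i` is the part of `S` in the triangular annulus of that scale; the ratio
  -- 4 of the scales makes these annuli disjoint.
  refine disjOccs_of_disjoint W (fun i hi => ⟨Finset.filter_subset _ _, ?_⟩) ?_
  · set n' := 4 ^ i * n with hn'
    have hn'0 : 0 < n' := by positivity
    have hnn' : n ≤ n' := Nat.le_mul_of_pos_left _ (by positivity)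
    have hn'N : n' ≤ 4 ^ N * n := Nat.mul_le_mul_right _ (Nat.pow_le_pow_right (by norm_num) hi.le)
    have hcross : ∀ i ∈ I, ∃ l, SideCross c n' l (T i) := by
      intro i hi
      obtain ⟨u, v, huv, hu, l, hv⟩ := hT i hi
      exact exists_sideCross hn'0 huv (fun l => by have := hu l; omega) ⟨l, by omega⟩
    choose! f hf using hcross
    -- Pigeonhole: one of the three sides is crossed by at least a third of the paths.
    obtain ⟨l, -, hl⟩ := Finset.exists_le_card_fiber_of_mul_le_card_of_maps_to
      (s := I) (t := (Finset.univ : Finset (Fin 3))) (f := f) (n := b * m) (fun _ _ => Finset.mem_univ _)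
      ⟨0, Finset.mem_univ _⟩ (by simpa using hI)
    refine ⟨l, ?_⟩
    set J := I.filter (fun i => f i = l) with hJ
    obtain ⟨W', hW', hd⟩ := exists_disjoint_hCross (x₀ := 6 * n') (x₁ := 12 * n')
      (y₀ := -(32 * n')) (y₁ := 32 * n') (by omega) (by omega)
      ((W i).map (chart c l).toEmbedding) J
      (fun j => chart c l '' T j ∩ rect (6 * n') (12 * n') (-(32 * n')) (32 * n'))
      (by
        rintro j hj z ⟨⟨y, hy, rfl⟩, hz⟩
        have hyA := mem_triAnnulus hn'0 hz
        refine Finset.mem_map_of_mem _ (Finset.mem_filter.2 ⟨?_, hyA⟩)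
        refine hTS j (Finset.mem_filter.1 hj).1 y hy ?_
        have := triAnnulus_subset c n' hyA
        rw [mem_rect] at *
        omega)
      (by
        intro j hj
        obtain ⟨hjI, hjl⟩ := Finset.mem_filter.1 hj
        have := hf j hjI
        rw [hjl] at this
        exact this.mono fun z hz => hz)
      (b := b) (m := m)
      (by
        intro z J' hJ' hz
        refine hmult ((chart c l).symm z) J' (hJ'.trans (Finset.filter_subset _ _)) fun j hj => ?_
        obtain ⟨⟨y, hy, rfl⟩, -⟩ := hz j hj
        simpa using hy)
      hb hl
    refine disjOccs_of_disjoint (fun j => (W' j).map (chart c l).symm.toEmbedding) ?_ ?_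
    · intro j hj
      obtain ⟨h1, h2⟩ := hW' j hj
      constructor
      · intro z hz
        rw [Finset.mem_map_equiv] at hz
        simpa [Finset.mem_map_equiv] using h1 hz
      · refine h2.mono fun z hz => ?_
        exact ⟨(chart c l).symm z, Finset.mem_map_of_mem _ hz.1, by simp⟩
    · intro i j hij hj
      exact (Finset.disjoint_map _).2 (hd i j hij hj)
  · intro i j hij _
    rw [Finset.disjoint_left]
    intro z h1 h2
    refine Set.disjoint_left.1 (disjoint_triAnnulus (c := c) (n := 4 ^ i * n) (n' := 4 ^ j * n) ?_)
      (Finset.mem_filter.1 h1).2 (Finset.mem_filter.1 h2).2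
    rw [← mul_assoc, ← pow_succ']
    exact Nat.mul_le_mul_right _ (Nat.pow_le_pow_right (by norm_num) hij)

/-! ### Percolation on finitely many sites -/

/-- The probability that a site has a given colour. -/
def colourProb (p : unitInterval) (c : Bool) : ℝ := if c then p else 1 - p

lemma colourProb_nonneg (p : unitInterval) (c : Bool) : 0 ≤ colourProb p c := by
  unfold colourProb
  split_ifs
  exacts [p.2.1, sub_nonneg.2 p.2.2]

lemma colourProb_not (p : unitInterval) (c : Bool) :
    colourProb p (!c) = 1 - colourProb p c := by
  cases c <;> simp [colourProb]

lemma bernoulliMeasure_singleton (p : unitInterval) (c : Bool) :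
    ProbabilityTheory.bernoulliMeasure true false p {c} = ENNReal.ofReal (colourProb p c) := by
  classical
  rw [ProbabilityTheory.bernoulliMeasure_apply p (measurableSet_singleton c)]
  cases c
  · simp [colourProb, ENNReal.ofReal, unitInterval.toNNReal]
    exact congrArg _ (Real.toNNReal_of_nonneg (sub_nonneg.2 p.2.2)).symm
  · simp [colourProb, ENNReal.ofReal, unitInterval.toNNReal]
    exact congrArg _ (Real.toNNReal_of_nonneg p.2.1).symm

lemma percolation_cylinder (p : unitInterval) (c : Bool) {S Λ : Finset Site} (hS : S ⊆ Λ) :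
    percolation p {ω | Λ.filter (fun v => ω v = c) = S} =
      ENNReal.ofReal (colourProb p c ^ S.card * (1 - colourProb p c) ^ (Λ \ S).card) := by
  have hset : {ω : Config | Λ.filter (fun v => ω v = c) = S} =
      Set.pi Λ fun v => {if v ∈ S then c else !c} := by
    ext ω
    simp only [Set.mem_ofPred_eq, Set.mem_pi, Finset.mem_coe, Set.mem_singleton_iff]
    constructor
    · intro h v hv
      have : v ∈ S ↔ ω v = c := by rw [← h]; simp [hv]
      split_ifs with hvS
      · exact this.1 hvS
      · exact Bool.eq_not.2 fun h => hvS (this.2 h)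
    · intro h
      ext v
      rw [Finset.mem_filter]
      constructor
      · rintro ⟨hv, hvc⟩
        by_contra hvS
        have := h v hv
        rw [if_neg hvS, hvc] at this
        simp at this
      · intro hvS
        have := h v (hS hvS)
        rw [if_pos hvS] at this
        exact ⟨hS hvS, this⟩
  rw [hset, percolation, Measure.infinitePi_pi _ fun _ _ => measurableSet_singleton _]
  simp only [bernoulliMeasure_singleton]
  rw [← ENNReal.ofReal_prod_of_nonneg fun _ _ => colourProb_nonneg _ _,
    ← Finset.prod_sdiff hS, mul_comm]
  congr 2
  · rw [Finset.prod_congr rfl fun v hv => by rw [if_pos hv], Finset.prod_const]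
  · rw [Finset.prod_congr rfl fun v hv => by rw [if_neg (Finset.mem_sdiff.1 hv).2],
      Finset.prod_const, colourProb_not]

/-- A union bound over the finitely many cylinders suffices, and requires no measurability of the
event. -/
lemma percolation_le_bern (p : unitInterval) (c : Bool) (Λ : Finset Site)
    (A : Finset Site → Prop) :
    percolation p {ω | A (Λ.filter fun v => ω v = c)} ≤
      ENNReal.ofReal (bern (colourProb p c) Λ A) := by
  classical
  have h0 := colourProb_nonneg p c
  have h1 : 0 ≤ 1 - colourProb p c := colourProb_not p c ▸ colourProb_nonneg p _
  rw [bern, ENNReal.ofReal_sum_of_nonneg fun S _ => by split_ifs <;> positivity]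
  refine (measure_mono (t := ⋃ S ∈ Λ.powerset.filter A,
    {ω : Config | Λ.filter (fun v => ω v = c) = S}) fun ω hω => ?_).trans ?_
  · simp only [Set.mem_iUnion]
    exact ⟨_, Finset.mem_filter.2 ⟨Finset.mem_powerset.2 (Finset.filter_subset _ _), hω⟩, rfl⟩
  · refine (measure_biUnion_finset_le _ _).trans ?_
    rw [Finset.sum_filter]
    refine Finset.sum_le_sum fun S hS => ?_
    split_ifs
    · exact (percolation_cylinder p c (Finset.mem_powerset.1 hS)).le
    · simp

lemma exists_colourProb_le (p : unitInterval) : ∃ c, colourProb p c ≤ 1 / 2 := by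
  rcases le_total (p : ℝ) (1 / 2) with h | h
  · exact ⟨true, by simpa [colourProb] using h⟩
  · exact ⟨false, by simp only [colourProb, Bool.false_eq_true, if_false]; linarith⟩

/-! ### The geometry of the hexagonal lattice -/

lemma pos_re (δ : ℝ) (v : Site) : (pos δ v).re = δ * (v.1 + v.2 / 2) := by
  simp [pos, axis, div_eq_mul_inv]

lemma pos_im (δ : ℝ) (v : Site) : (pos δ v).im = δ * (v.2 * (√3 / 2)) := by
  simp [pos, axis]

lemma sq_norm_sub (z w : ℂ) : ‖z - w‖ ^ 2 = (z.re - w.re) ^ 2 + (z.im - w.im) ^ 2 := by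
  rw [Complex.sq_norm, Complex.normSq_apply]; simp; ring

lemma sq_sqrt_three : √(3 : ℝ) ^ 2 = 3 := Real.sq_sqrt (by norm_num)

lemma sq_norm_pos_sub (δ : ℝ) (v w : Site) : ‖pos δ v - pos δ w‖ ^ 2 =
    δ ^ 2 * (((v.1 - w.1) ^ 2 + (v.1 - w.1) * (v.2 - w.2) + (v.2 - w.2) ^ 2 : ℤ) : ℝ) := by
  rw [sq_norm_sub, pos_re, pos_re, pos_im, pos_im]
  push_cast
  linear_combination (δ ^ 2 * (v.2 - w.2) ^ 2 / 4) * sq_sqrt_three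

lemma Adj.norm_form {v w : Site} (h : Adj v w) :
    (v.1 - w.1) ^ 2 + (v.1 - w.1) * (v.2 - w.2) + (v.2 - w.2) ^ 2 = 1 := by
  rw [adj_iff] at h
  rcases h with ⟨h1, h2⟩ | ⟨h1, h2⟩ | ⟨h1, h2⟩ | ⟨h1, h2⟩ | ⟨h1, h2⟩ | ⟨h1, h2⟩ <;>
    rw [h1, h2] <;> ring

lemma Adj.sq_norm {v w : Site} (h : Adj v w) (δ : ℝ) : ‖pos δ v - pos δ w‖ ^ 2 = δ ^ 2 := by
  rw [sq_norm_pos_sub, h.norm_form]; simp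

lemma hexEdge_comm (δ : ℝ) (v w : Site) : hexEdge δ v w = hexEdge δ w v := by
  unfold hexEdge
  rw [segment_symm]
  congr 1 <;> ring

lemma sq_norm_le_of_mem_hexEdge {δ : ℝ} {v w : Site} (h : Adj v w) {z : ℂ}
    (hz : z ∈ hexEdge δ v w) : ‖z - pos δ v‖ ^ 2 ≤ δ ^ 2 / 3 := by
  have h3 : √(3 : ℝ) ≠ 0 := by positivity
  -- The signs `ε = ±1` give the two ends of the edge; their squared distance from the site, in
  -- units of `δ ^ 2`, is `1 / 4 + 1 / 12 = 1 / 3`.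
  have key : ∀ ε : ℝ, ε ^ 2 = 1 →
      (pos δ v + pos δ w) / 2 + ε * (Complex.I * (pos δ w - pos δ v) / (2 * (√3 : ℂ))) ∈
        Metric.closedBall (pos δ v) √(δ ^ 2 / 3) := by
    intro ε hε
    rw [mem_closedBall_iff_norm]
    apply Real.le_sqrt_of_sq_le
    have e1 : (pos δ v + pos δ w) / 2 + ε * (Complex.I * (pos δ w - pos δ v) / (2 * (√3 : ℂ)))
        - pos δ v = (pos δ w - pos δ v) * ((1 / 2 : ℝ) + (ε / (2 * √3) : ℝ) * Complex.I) := by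
      push_cast; ring
    rw [e1, norm_mul, mul_pow, h.symm.sq_norm, Complex.sq_norm, Complex.normSq_add_mul_I,
      div_pow ε, hε, mul_pow 2 √(3 : ℝ), sq_sqrt_three]
    apply le_of_eq; ring
  have k1 := key (-1) (by norm_num)
  have k2 := key 1 (by norm_num)
  have hsub := (convex_closedBall (pos δ v) √(δ ^ 2 / 3)).segment_subset k1 k2
  have hz' : z ∈ Metric.closedBall (pos δ v) √(δ ^ 2 / 3) := by
    apply hsub
    simpa [hexEdge, sub_eq_add_neg] using hz
  rw [mem_closedBall_iff_norm] at hz'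
  calc ‖z - pos δ v‖ ^ 2 ≤ √(δ ^ 2 / 3) ^ 2 := by gcongr
    _ = δ ^ 2 / 3 := Real.sq_sqrt (by positivity)

lemma sq_norm_le_of_mem_hexEdge' {δ : ℝ} {v w : Site} (h : Adj v w) {z : ℂ}
    (hz : z ∈ hexEdge δ v w) : ‖z - pos δ w‖ ^ 2 ≤ δ ^ 2 / 3 :=
  sq_norm_le_of_mem_hexEdge h.symm (hexEdge_comm δ v w ▸ hz)

lemma norm_le_of_sq_le {δ : ℝ} (hδ : 0 < δ) {z : ℂ} (h : ‖z‖ ^ 2 ≤ δ ^ 2 / 3) : ‖z‖ ≤ δ := by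
  nlinarith [norm_nonneg z]

/-- The hexagons around two sites which have a common point are equal or adjacent. -/
lemma eq_or_adj_of_near {δ : ℝ} (hδ : 0 < δ) {v w : Site} {z : ℂ}
    (hv : ‖z - pos δ v‖ ^ 2 ≤ δ ^ 2 / 3) (hw : ‖z - pos δ w‖ ^ 2 ≤ δ ^ 2 / 3) :
    v = w ∨ Adj v w := by
  have h1 : ‖pos δ v - pos δ w‖ ≤ ‖z - pos δ v‖ + ‖z - pos δ w‖ := by
    have := norm_sub_le (z - pos δ w) (z - pos δ v)
    rw [sub_sub_sub_cancel_left] at this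
    linarith
  have h2 : ‖pos δ v - pos δ w‖ ^ 2 ≤ 4 / 3 * δ ^ 2 := by
    have h3 := pow_le_pow_left₀ (norm_nonneg _) h1 2
    nlinarith [sq_nonneg (‖z - pos δ v‖ - ‖z - pos δ w‖)]
  rw [sq_norm_pos_sub] at h2
  set a := v.1 - w.1 with ha
  set b := v.2 - w.2 with hb
  -- In units of `δ ^ 2` the squared distance of two sites is an integer; being at most `4 / 3`, it
  -- is 0 or 1.
  have h4 : ((a ^ 2 + a * b + b ^ 2 : ℤ) : ℝ) < (2 : ℤ) := by
    push_cast at h2 ⊢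
    have : 0 < δ ^ 2 := by positivity
    nlinarith
  have h5 : a ^ 2 + a * b + b ^ 2 < 2 := Int.cast_lt.1 h4
  have a1 : a ≤ 1 := by nlinarith [sq_nonneg (a + 2 * b)]
  have a2 : -1 ≤ a := by nlinarith [sq_nonneg (a + 2 * b)]
  have b1 : b ≤ 1 := by nlinarith [sq_nonneg (2 * a + b)]
  have b2 : -1 ≤ b := by nlinarith [sq_nonneg (2 * a + b)]
  rw [adj_iff, Prod.ext_iff]
  have h6 : ¬ (a = 1 ∧ b = 1) := by rintro ⟨h, h'⟩; rw [h, h'] at h5; norm_num at h5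
  have h7 : ¬ (a = -1 ∧ b = -1) := by rintro ⟨h, h'⟩; rw [h, h'] at h5; norm_num at h5
  clear h1 h2 h4 h5 hv hw
  omega

/-- The common point of the hexagons around three mutually adjacent sites. -/
lemma eq_centroid {δ : ℝ} {u v w : Site} (huv : Adj u v) (hvw : Adj v w) (huw : Adj u w) {z : ℂ}
    (hu : ‖z - pos δ u‖ ^ 2 ≤ δ ^ 2 / 3) (hv : ‖z - pos δ v‖ ^ 2 ≤ δ ^ 2 / 3)
    (hw : ‖z - pos δ w‖ ^ 2 ≤ δ ^ 2 / 3) : z = (pos δ u + pos δ v + pos δ w) / 3 := by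
  have e1 := huv.sq_norm δ
  have e2 := hvw.sq_norm δ
  have e3 := huw.sq_norm δ
  rw [sq_norm_sub] at *
  set a := pos δ u
  set b := pos δ v
  set c := pos δ w
  -- The three squared distances sum to three times the squared distance from the centroid plus a
  -- third of the sum of the squared sides, which is `δ ^ 2`; by hypothesis they sum to at most `δ ^
  -- 2`.
  have h3 : (z.re - (a.re + b.re + c.re) / 3) ^ 2 + (z.im - (a.im + b.im + c.im) / 3) ^ 2 ≤ 0 := by
    nlinarith
  have hre : z.re - (a.re + b.re + c.re) / 3 = 0 := by
    apply pow_eq_zero_iff (two_ne_zero) |>.1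
    nlinarith [sq_nonneg (z.re - (a.re + b.re + c.re) / 3),
      sq_nonneg (z.im - (a.im + b.im + c.im) / 3)]
  have him : z.im - (a.im + b.im + c.im) / 3 = 0 := by
    apply pow_eq_zero_iff (two_ne_zero) |>.1
    nlinarith [sq_nonneg (z.re - (a.re + b.re + c.re) / 3),
      sq_nonneg (z.im - (a.im + b.im + c.im) / 3)]
  apply Complex.ext
  · simp; linarith
  · simp; linarith

/-! ### Oblique coordinates and boxes -/

/-- The coordinates of a point of the plane with respect to the axes of the lattice. -/
def coordA (z : ℂ) : ℝ := z.re - z.im / √3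

/-- The coordinates of a point of the plane with respect to the axes of the lattice. -/
def coordB (z : ℂ) : ℝ := 2 * z.im / √3

lemma coordA_pos (δ : ℝ) (v : Site) : coordA (pos δ v) = δ * v.1 := by
  have : √(3 : ℝ) ≠ 0 := by positivity
  rw [coordA, pos_re, pos_im]; field_simp; ring

lemma coordB_pos (δ : ℝ) (v : Site) : coordB (pos δ v) = δ * v.2 := by
  have : √(3 : ℝ) ≠ 0 := by positivity
  rw [coordB, pos_im]; field_simp

lemma coordA_sub (z w : ℂ) : coordA (z - w) = coordA z - coordA w := by
  simp [coordA]; ring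

lemma coordB_sub (z w : ℂ) : coordB (z - w) = coordB z - coordB w := by
  simp [coordB]; ring

lemma abs_coordA_le (z : ℂ) : |coordA z| ≤ 2 * ‖z‖ := by
  have h1 : (1 : ℝ) ≤ √3 := Real.one_le_sqrt.2 (by norm_num)
  have h2 : |z.im / √3| ≤ |z.im| := by
    rw [abs_div, abs_of_pos (by positivity : (0 : ℝ) < √3)]
    exact div_le_self (abs_nonneg _) h1
  have h3 := abs_sub z.re (z.im / √3)
  have h4 := Complex.abs_re_le_norm z
  have h5 := Complex.abs_im_le_norm z
  unfold coordA
  linarith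

lemma abs_coordB_le (z : ℂ) : |coordB z| ≤ 2 * ‖z‖ := by
  have h1 : (1 : ℝ) ≤ √3 := Real.one_le_sqrt.2 (by norm_num)
  have h2 : |2 * z.im / √3| ≤ |2 * z.im| := by
    rw [abs_div, abs_of_pos (by positivity : (0 : ℝ) < √3)]
    exact div_le_self (abs_nonneg _) h1
  rw [abs_mul, abs_two] at h2
  have h5 := Complex.abs_im_le_norm z
  unfold coordB
  linarith

lemma continuous_coordA : Continuous coordA := by unfold coordA; fun_prop

lemma continuous_coordB : Continuous coordB := by unfold coordB; fun_prop

lemma mem_box_iff {x z : ℂ} {r : ℝ} :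
    z ∈ box x r ↔ |coordA (z - x)| ≤ r / 2 ∧ |coordB (z - x)| ≤ r / 2 := by
  have h3 : √(3 : ℝ) ≠ 0 := by positivity
  constructor
  · rintro ⟨s, t, hs, ht, rfl⟩
    have e1 : coordA (x + s + t * axis - x) = s := by
      simp [coordA, axis]; field_simp; ring
    have e2 : coordB (x + s + t * axis - x) = t := by
      simp [coordB, axis]; field_simp
    rw [e1, e2]; exact ⟨hs, ht⟩
  · rintro ⟨h1, h2⟩
    refine ⟨_, _, h1, h2, ?_⟩
    apply Complex.ext
    · simp [coordA, coordB, axis]; field_simp; ring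
    · simp [coordB, axis]; field_simp; ring

lemma isClosed_box (x : ℂ) (r : ℝ) : IsClosed (box x r) := by
  have : box x r = {z | |coordA (z - x)| ≤ r / 2} ∩ {z | |coordB (z - x)| ≤ r / 2} := by
    ext z; exact mem_box_iff
  rw [this]
  have c1 := continuous_coordA
  have c2 := continuous_coordB
  exact (isClosed_le (by fun_prop) (by fun_prop)).inter (isClosed_le (by fun_prop) (by fun_prop))

lemma le_of_mem_frontier_box {x z : ℂ} {r : ℝ} (hz : z ∈ frontier (box x r)) :
    |coordA (z - x)| ≤ r / 2 ∧ |coordB (z - x)| ≤ r / 2 :=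
  mem_box_iff.1 ((isClosed_box x r).frontier_subset hz)

lemma ge_of_mem_frontier_box {x z : ℂ} {r : ℝ} (hz : z ∈ frontier (box x r)) :
    r / 2 ≤ |coordA (z - x)| ∨ r / 2 ≤ |coordB (z - x)| := by
  by_contra! hcon
  refine hz.2 ?_
  have c1 := continuous_coordA
  have c2 := continuous_coordB
  refine mem_interior.2 ⟨{z | |coordA (z - x)| < r / 2} ∩ {z | |coordB (z - x)| < r / 2}, ?_,
    (isOpen_lt (by fun_prop) (by fun_prop)).inter (isOpen_lt (by fun_prop) (by fun_prop)), hcon⟩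
  rintro y ⟨h1, h2⟩
  exact mem_box_iff.2 ⟨le_of_lt h1, le_of_lt h2⟩

/-! ### The sites along a segment of an interface -/

lemma isCompact_hexEdge (δ : ℝ) (v w : Site) : IsCompact (hexEdge δ v w) := by
  rw [hexEdge, ← convexHull_pair]
  exact (Set.toFinite _).isCompact_convexHull ℝ

/-- In a finite closed cover of a connected set, there is no way to pass from one part of the
cover to its complement without meeting both at a common point. -/
lemma _root_.IsPreconnected.exists_mem_inter {X ι : Type*} [TopologicalSpace X] {K : Set X}
    (hK : IsPreconnected K) {E : Set ι} (hE : E.Finite) {F : ι → Set X}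
    (hF : ∀ e ∈ E, IsClosed (F e)) (hFK : ∀ e ∈ E, (F e ∩ K).Nonempty)
    (hcov : ∀ z ∈ K, ∃ e ∈ E, z ∈ F e) {P : ι → Prop} {e f : ι} (he : e ∈ E) (hf : f ∈ E)
    (hPe : P e) (hPf : ¬ P f) :
    ∃ e₁ ∈ E, ∃ e₂ ∈ E, P e₁ ∧ ¬ P e₂ ∧ ∃ z ∈ K, z ∈ F e₁ ∧ z ∈ F e₂ := by
  have hcl : ∀ Q : ι → Prop, IsClosed (⋃ e ∈ {e ∈ E | Q e}, F e) := fun Q =>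
    (hE.subset (Set.sep_subset _ _)).isClosed_biUnion fun e he => hF e he.1
  have hne : ∀ Q : ι → Prop, ∀ e ∈ E, Q e → (K ∩ ⋃ e ∈ {e ∈ E | Q e}, F e).Nonempty := by
    intro Q e he hQ
    obtain ⟨z, hz, hzK⟩ := hFK e he
    exact ⟨z, hzK, Set.mem_biUnion (show e ∈ {e ∈ E | Q e} from ⟨he, hQ⟩) hz⟩
  obtain ⟨z, hzK, hz₁, hz₂⟩ := isPreconnected_closed_iff.1 hK _ _ (hcl P) (hcl fun e => ¬ P e)
    (fun z hz => by
      obtain ⟨e, he, hze⟩ := hcov z hz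
      by_cases hP : P e
      · exact Or.inl (Set.mem_biUnion (show e ∈ {e ∈ E | P e} from ⟨he, hP⟩) hze)
      · exact Or.inr (Set.mem_biUnion (show e ∈ {e ∈ E | ¬ P e} from ⟨he, hP⟩) hze))
    (hne P e he hPe) (hne _ f hf hPf)
  obtain ⟨e₁, he₁, hz₁⟩ := Set.mem_iUnion₂.1 hz₁
  obtain ⟨e₂, he₂, hz₂⟩ := Set.mem_iUnion₂.1 hz₂
  exact ⟨e₁, he₁.1, e₂, he₂.1, he₁.2, he₂.2, z, hzK, hz₁, hz₂⟩

/-- The oriented edges of the hexagonal lattice which meet `K`, with colour `c` at the first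
site and the other colour at the second site. -/
def trailEdges (δ : ℝ) (ω : Config) (c : Bool) (K : Set ℂ) : Set (Site × Site) :=
  {e | Adj e.1 e.2 ∧ ω e.1 = c ∧ ω e.2 ≠ c ∧ (hexEdge δ e.1 e.2 ∩ K).Nonempty}

/-- The sites of colour `c` along the set `K` of points of interfaces. -/
def trail (δ : ℝ) (ω : Config) (c : Bool) (K : Set ℂ) : Set Site :=
  Prod.fst '' trailEdges δ ω c K

/-- A set of points on interface edges. -/
def OnInterface (δ : ℝ) (ω : Config) (K : Set ℂ) : Prop :=
  ∀ z ∈ K, ∃ v w, Adj v w ∧ ω v ≠ ω w ∧ z ∈ hexEdge δ v w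

section Trail

variable {δ : ℝ} {ω : Config} {c : Bool} {K : Set ℂ}

lemma OnInterface.exists_mem_trailEdges (hK : OnInterface δ ω K) (c : Bool) :
    ∀ z ∈ K, ∃ e ∈ trailEdges δ ω c K, z ∈ hexEdge δ e.1 e.2 := by
  intro z hz
  obtain ⟨v, w, hvw, hne, hzvw⟩ := hK z hz
  by_cases hv : ω v = c
  · exact ⟨(v, w), ⟨hvw, hv, fun hw => hne (hv.trans hw.symm), z, hzvw, hz⟩, hzvw⟩
  · have hw : ω w = c := by
      revert hv hne
      cases ω v <;> cases ω w <;> cases c <;> simp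
    have hzwv : z ∈ hexEdge δ w v := hexEdge_comm δ v w ▸ hzvw
    exact ⟨(w, v), ⟨hvw.symm, hw, hv, z, hzwv, hz⟩, hzwv⟩

lemma finite_near (hδ : 0 < δ) (M : ℝ) : {v : Site | ‖pos δ v‖ ≤ M}.Finite := by
  refine (Set.finite_Icc (-⌈2 * M / δ⌉, -⌈2 * M / δ⌉) (⌈2 * M / δ⌉, ⌈2 * M / δ⌉)).subset ?_
  intro v hv
  have hv : ‖pos δ v‖ ≤ M := hv
  have key : ∀ a : ℤ, |δ * a| ≤ 2 * ‖pos δ v‖ → -⌈2 * M / δ⌉ ≤ a ∧ a ≤ ⌈2 * M / δ⌉ := by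
    intro a ha
    rw [abs_mul, abs_of_pos hδ] at ha
    have : ((|a| : ℤ) : ℝ) ≤ 2 * M / δ := by
      rw [le_div_iff₀ hδ]; push_cast; linarith
    exact abs_le.1 (Int.cast_le.1 (this.trans (Int.le_ceil _)))
  have h1 := key v.1 (by rw [← coordA_pos]; exact abs_coordA_le _)
  have h2 := key v.2 (by rw [← coordB_pos]; exact abs_coordB_le _)
  exact ⟨⟨h1.1, h2.1⟩, ⟨h1.2, h2.2⟩⟩

lemma finite_trailEdges (hδ : 0 < δ) (ω : Config) (c : Bool) (hK : IsCompact K) :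
    (trailEdges δ ω c K).Finite := by
  obtain ⟨M, hM⟩ := hK.isBounded.exists_norm_le
  refine ((finite_near hδ (M + δ)).prod (finite_near hδ (M + δ))).subset ?_
  rintro ⟨v, w⟩ ⟨hvw, -, -, z, hz, hzK⟩
  have h1 := norm_le_of_sq_le hδ (sq_norm_le_of_mem_hexEdge hvw hz)
  have h2 := norm_le_of_sq_le hδ (sq_norm_le_of_mem_hexEdge' hvw hz)
  have h3 := hM z hzK
  constructor
  · have := norm_le_norm_add_norm_sub z (pos δ v)
    show ‖pos δ v‖ ≤ M + δ
    linarith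
  · have := norm_le_norm_add_norm_sub z (pos δ w)
    show ‖pos δ w‖ ≤ M + δ
    linarith

lemma exists_switch (hδ : 0 < δ) (hK : IsCompact K) (hK' : IsPreconnected K)
    (hKω : OnInterface δ ω K) {P : Site × Site → Prop} {e f : Site × Site}
    (he : e ∈ trailEdges δ ω c K) (hf : f ∈ trailEdges δ ω c K) (hPe : P e) (hPf : ¬ P f) :
    ∃ e₁ ∈ trailEdges δ ω c K, ∃ e₂ ∈ trailEdges δ ω c K, P e₁ ∧ ¬ P e₂ ∧
      ∃ z ∈ K, z ∈ hexEdge δ e₁.1 e₁.2 ∧ z ∈ hexEdge δ e₂.1 e₂.2 :=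
  hK'.exists_mem_inter (finite_trailEdges hδ ω c hK) (F := fun e => hexEdge δ e.1 e.2)
    (fun e _ => (isCompact_hexEdge δ e.1 e.2).isClosed) (fun _ h => h.2.2.2)
    (hKω.exists_mem_trailEdges c) he hf hPe hPf

/-- `K` is connected and covered by finitely many closed edges, so a proper part of the edges shares
a point with the rest. Sites whose hexagons share a point are equal or adjacent, so the component of
`u` cannot be a proper part. -/
lemma linked_trail (hδ : 0 < δ) (hK : IsCompact K) (hK' : IsPreconnected K)
    (hKω : OnInterface δ ω K) {u v : Site} (hu : u ∈ trail δ ω c K) (hv : v ∈ trail δ ω c K) :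
    Linked Adj (trail δ ω c K) u v := by
  obtain ⟨e, he, rfl⟩ := hu
  obtain ⟨f, hf, rfl⟩ := hv
  by_contra hcon
  obtain ⟨e₁, he₁, e₂, he₂, h₁, h₂, z, -, hz₁, hz₂⟩ := exists_switch hδ hK hK' hKω
    (P := fun g => Linked Adj (trail δ ω c K) e.1 g.1) he hf
    (Linked.refl (Set.mem_image_of_mem _ he)) hcon
  rcases eq_or_adj_of_near hδ (sq_norm_le_of_mem_hexEdge he₁.1 hz₁)
    (sq_norm_le_of_mem_hexEdge he₂.1 hz₂) with h | h
  · exact h₂ (h ▸ h₁)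
  · exact h₂ (h₁.tail h (Set.mem_image_of_mem _ he₂))

/-- A segment of an interface which is not contained in a single edge passes through a vertex of
every hexagon along it. -/
lemma exists_centroid_mem (hδ : 0 < δ) (hK : IsCompact K) (hK' : IsPreconnected K)
    (hKω : OnInterface δ ω K) (hKe : ∀ v w, Adj v w → ¬ K ⊆ hexEdge δ v w) {v : Site}
    (hv : v ∈ trail δ ω c K) :
    ∃ w u, Adj v w ∧ Adj v u ∧ (pos δ v + pos δ w + pos δ u) / 3 ∈ K := by
  obtain ⟨⟨v, w⟩, he, rfl⟩ := hv
  obtain ⟨y, hyK, hy⟩ := Set.not_subset.1 (hKe v w he.1)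
  obtain ⟨f, hf, hyf⟩ := hKω.exists_mem_trailEdges c y hyK
  have hfe : ¬ f = (v, w) := by rintro rfl; exact hy hyf
  obtain ⟨_, -, ⟨v₂, w₂⟩, he₂, rfl, hne, z, hzK, hz, hz₂⟩ :=
    exists_switch hδ hK hK' hKω (P := fun g => g = (v, w)) he hf rfl hfe
  have nv := sq_norm_le_of_mem_hexEdge he.1 hz
  have nw := sq_norm_le_of_mem_hexEdge' he.1 hz
  have nv₂ := sq_norm_le_of_mem_hexEdge he₂.1 hz₂
  have nw₂ := sq_norm_le_of_mem_hexEdge' he₂.1 hz₂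
  -- The common point of two distinct edges lies in the hexagons of `v`, `w` and a third site, which
  -- is `w₂` or `v₂`; the colours exclude `w = v₂`.
  rcases eq_or_adj_of_near hδ nv nv₂ with h | h
  · have h : v = v₂ := h
    subst h
    rcases eq_or_adj_of_near hδ nw nw₂ with h' | h'
    · exact absurd (congrArg _ h'.symm) hne
    · exact ⟨w, w₂, he.1, he₂.1, eq_centroid he.1 h' he₂.1 nv nw nw₂ ▸ hzK⟩
  · rcases eq_or_adj_of_near hδ nw nv₂ with h' | h'
    · exact absurd ((congrArg ω h').trans he₂.2.1) he.2.2.1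
    · exact ⟨w, v₂, he.1, h, eq_centroid he.1 h' h nv nw nv₂ ▸ hzK⟩

/-- A site lies on a bounded number of disjoint segments of interfaces. -/
lemma card_trail_le (hδ : 0 < δ) {ι : Type*} {K : ι → Set ℂ} (hK : ∀ i, IsCompact (K i))
    (hK' : ∀ i, IsPreconnected (K i)) (hKω : ∀ i, OnInterface δ ω (K i))
    (hKe : ∀ i v w, Adj v w → ¬ K i ⊆ hexEdge δ v w)
    (hdisj : ∀ i j, i ≠ j → Disjoint (K i) (K j)) {v : Site} {J : Finset ι}
    (hJ : ∀ i ∈ J, v ∈ trail δ ω c (K i)) : J.card ≤ 81 := by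
  have hex : ∀ i, ∃ q : Site × Site, i ∈ J →
      Adj v q.1 ∧ Adj v q.2 ∧ (pos δ v + pos δ q.1 + pos δ q.2) / 3 ∈ K i := by
    intro i
    by_cases hi : i ∈ J
    · obtain ⟨w, u, h⟩ := exists_centroid_mem hδ (hK i) (hK' i) (hKω i) (hKe i) (hJ i hi)
      exact ⟨(w, u), fun _ => h⟩
    · exact ⟨(v, v), fun h => absurd h hi⟩
  choose q hq using hex
  have hnb : ∀ w, Adj v w → w ∈ rectFin (v.1 - 1) (v.1 + 1) (v.2 - 1) (v.2 + 1) := by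
    intro w hw
    rw [adj_iff] at hw
    rw [mem_rectFin]
    omega
  have hcard : (rectFin (v.1 - 1) (v.1 + 1) (v.2 - 1) (v.2 + 1)).card = 9 := by
    have h1 : v.1 + 1 + 1 - (v.1 - 1) = 3 := by ring
    have h2 : v.2 + 1 + 1 - (v.2 - 1) = 3 := by ring
    rw [rectFin, Finset.card_product, Int.card_Icc, Int.card_Icc, h1, h2]
    rfl
  -- Each segment contains a vertex of the hexagon of `v`, named by two neighbours of `v`. Disjoint
  -- segments have different vertices, and there are at most `9 * 9` such pairs.
  calc J.card ≤ ((rectFin (v.1 - 1) (v.1 + 1) (v.2 - 1) (v.2 + 1)) ×ˢ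
        (rectFin (v.1 - 1) (v.1 + 1) (v.2 - 1) (v.2 + 1))).card := by
        refine Finset.card_le_card_of_injOn q (fun i hi => ?_) fun i hi j hj hij => ?_
        · exact Finset.mem_product.2 ⟨hnb _ (hq i hi).1, hnb _ (hq i hi).2.1⟩
        · by_contra hne
          refine Set.disjoint_left.1 (hdisj i j hne) (hq i hi).2.2 ?_
          rw [hij]
          exact (hq j hj).2.2
    _ = 81 := by rw [Finset.card_product, hcard]

lemma OnInterface.exists_near (hδ : 0 < δ) (hKω : OnInterface δ ω K) (c : Bool) {z : ℂ}
    (hz : z ∈ K) : ∃ v ∈ trail δ ω c K, ‖z - pos δ v‖ ≤ δ := by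
  obtain ⟨e, he, hze⟩ := hKω.exists_mem_trailEdges c z hz
  exact ⟨e.1, Set.mem_image_of_mem _ he,
    norm_le_of_sq_le hδ (sq_norm_le_of_mem_hexEdge he.1 hze)⟩

end Trail

/-! ### Crossings of annuli by interfaces -/

lemma chart_fst_lt {n : ℕ} {o u : Site} (hn : 2 ≤ n) (h1 : |u.1 - o.1| ≤ 2 * n)
    (h2 : |u.2 - o.2| ≤ 2 * n) (l : Fin 3) : (chart o l u).1 < 6 * n := by
  rw [abs_le] at h1 h2
  fin_cases l
  · show (chart o 0 u).1 < _
    rw [chart_zero]; dsimp only; omega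
  · show (chart o 1 u).1 < _
    rw [chart_one]; dsimp only; omega
  · show (chart o 2 u).1 < _
    rw [chart_two]; dsimp only; omega

lemma exists_le_chart_fst {M : ℕ} {o v : Site}
    (h : 24 * (M : ℤ) ≤ |v.1 - o.1| ∨ 24 * (M : ℤ) ≤ |v.2 - o.2|) :
    ∃ l, 12 * (M : ℤ) ≤ (chart o l v).1 := by
  by_contra! hcon
  have h0 := hcon 0
  have h1 := hcon 1
  have h2 := hcon 2
  rw [chart_zero] at h0
  rw [chart_one] at h1
  rw [chart_two] at h2
  dsimp only at h0 h1 h2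
  rw [le_abs, le_abs] at h
  omega

/-- The lattice coordinate of a site near a point, in terms of the coordinate of that point. -/
lemma abs_sub_floor_le {δ a x : ℝ} {m : ℤ} (hδ : 0 < δ) (h : |a - δ * m| ≤ 2 * δ) :
    |((m - ⌊x / δ⌋ : ℤ) : ℝ) - (a - x) / δ| ≤ 3 := by
  have e : (a - x) / δ = (a - δ * m) / δ + m - x / δ := by field_simp; ring
  have h1 : |(a - δ * m) / δ| ≤ 2 := by
    rw [abs_div, abs_of_pos hδ, div_le_iff₀ hδ]; exact h
  have h2 := Int.floor_le (x / δ)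
  have h3 := Int.lt_floor_add_one (x / δ)
  rw [abs_le] at h1 ⊢
  rw [e]; push_cast
  constructor <;> linarith

/-- The site of the lattice used as the centre for a point of the plane. -/
def nearSite (δ : ℝ) (x : ℂ) : Site := (⌊coordA x / δ⌋, ⌊coordB x / δ⌋)

/-- The error 3 consists of 2 for the distance from `z` to the site and 1 for rounding the centre.
-/
lemma abs_sub_nearSite_le {δ : ℝ} (hδ : 0 < δ) {x z : ℂ} {v : Site} (h : ‖z - pos δ v‖ ≤ δ) :
    |((v.1 - (nearSite δ x).1 : ℤ) : ℝ) - coordA (z - x) / δ| ≤ 3 ∧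
      |((v.2 - (nearSite δ x).2 : ℤ) : ℝ) - coordB (z - x) / δ| ≤ 3 := by
  have hA := abs_coordA_le (z - pos δ v)
  have hB := abs_coordB_le (z - pos δ v)
  rw [coordA_sub, coordA_pos] at hA
  rw [coordB_sub, coordB_pos] at hB
  rw [coordA_sub, coordB_sub]
  exact ⟨abs_sub_floor_le hδ (by linarith), abs_sub_floor_le hδ (by linarith)⟩

section Crossing

variable {δ r R : ℝ} {x : ℂ} {N : ℕ} {ω : Config}

/-- The radius of the innermost annulus around `nearSite δ x`. -/
def innerRadius (δ r : ℝ) : ℕ := 2 * ⌈r / δ⌉₊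

lemma two_le_innerRadius (hδ : 0 < δ) (hr : δ ≤ r) : 2 ≤ innerRadius δ r := by
  have : 0 < ⌈r / δ⌉₊ := Nat.ceil_pos.2 (div_pos (hδ.trans_le hr) hδ)
  unfold innerRadius
  omega

lemma le_innerRadius (δ r : ℝ) : 2 * (r / δ) ≤ innerRadius δ r := by
  unfold innerRadius
  push_cast
  linarith [Nat.le_ceil (r / δ)]

lemma innerRadius_le (hδ : 0 < δ) (hr : δ ≤ r) : (innerRadius δ r : ℝ) ≤ 4 * (r / δ) := by
  have h1 : 1 ≤ r / δ := (one_le_div hδ).2 hr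
  have := Nat.ceil_lt_add_one (zero_le_one.trans h1)
  unfold innerRadius
  push_cast
  linarith

lemma chart_lt_of_mem_frontier (hδ : 0 < δ) (hr : δ ≤ r) {z : ℂ} {u : Site}
    (hz : z ∈ frontier (box x r)) (hu : ‖z - pos δ u‖ ≤ δ) (l : Fin 3) :
    (chart (nearSite δ x) l u).1 < 6 * innerRadius δ r := by
  obtain ⟨hA, hB⟩ := abs_sub_nearSite_le (x := x) hδ hu
  obtain ⟨zA, zB⟩ := le_of_mem_frontier_box hz
  have h1 : 1 ≤ r / δ := (one_le_div hδ).2 hr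
  have h2 := le_innerRadius δ r
  have key : ∀ (a : ℝ) (m : ℤ), |a| ≤ r / 2 → |(m : ℝ) - a / δ| ≤ 3 →
      |m| ≤ 2 * innerRadius δ r := by
    intro a m ha hm
    have ha' : |a / δ| ≤ r / δ / 2 := by
      rw [abs_div, abs_of_pos hδ, div_right_comm]; gcongr
    have : ((|m| : ℤ) : ℝ) ≤ ((2 * innerRadius δ r : ℤ) : ℝ) := by
      push_cast
      rw [abs_le] at *
      constructor <;> linarith
    exact_mod_cast this
  exact chart_fst_lt (two_le_innerRadius hδ hr) (key _ _ zA hA) (key _ _ zB hB) l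

/-- With `X = 4 ^ N * (r / δ) ≥ 1`, some lattice coordinate relative to the centre is at least `100
* X - 3`, while `24 * 4 ^ N * innerRadius δ r ≤ 96 * X`. This is where the constant 200 comes from.
-/
lemma exists_le_chart_of_mem_frontier (hδ : 0 < δ) (hr : δ ≤ r) (hR : 200 * 4 ^ N * r ≤ R)
    {z : ℂ} {v : Site} (hz : z ∈ frontier (box x R)) (hv : ‖z - pos δ v‖ ≤ δ) :
    ∃ l, 12 * ((4 ^ N * innerRadius δ r : ℕ) : ℤ) ≤ (chart (nearSite δ x) l v).1 := by
  obtain ⟨hA, hB⟩ := abs_sub_nearSite_le (x := x) hδ hv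
  have h1 : 1 ≤ r / δ := (one_le_div hδ).2 hr
  have h2 := innerRadius_le hδ hr
  have h4 : (1 : ℝ) ≤ 4 ^ N := one_le_pow₀ (by norm_num)
  have h5 : 4 ^ N * (innerRadius δ r : ℝ) ≤ 4 ^ N * (4 * (r / δ)) := by gcongr
  have h6 : 1 ≤ 4 ^ N * (r / δ) := one_le_mul_of_one_le_of_one_le h4 h1
  have key : ∀ (a : ℝ) (m : ℤ), R / 2 ≤ |a| → |(m : ℝ) - a / δ| ≤ 3 →
      24 * ((4 ^ N * innerRadius δ r : ℕ) : ℤ) ≤ |m| := by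
    intro a m ha hm
    have ha' : 100 * (4 ^ N * (r / δ)) ≤ |a / δ| := by
      rw [abs_div, abs_of_pos hδ, le_div_iff₀ hδ]
      calc 100 * (4 ^ N * (r / δ)) * δ = 200 * 4 ^ N * r / 2 := by field_simp; ring
        _ ≤ |a| := by linarith
    have h7 := abs_sub_abs_le_abs_sub (a / δ) m
    rw [abs_sub_comm] at h7
    have : ((24 * (4 ^ N * innerRadius δ r : ℕ) : ℤ) : ℝ) ≤ ((|m| : ℤ) : ℝ) := by
      push_cast
      linarith
    exact Int.cast_le.1 this
  rcases ge_of_mem_frontier_box hz with h | h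
  · exact exists_le_chart_fst (Or.inl (key _ _ h hA))
  · exact exists_le_chart_fst (Or.inr (key _ _ h hB))

/-- An edge is too short to join the two boundaries. This excludes segments inside one edge, for
which the bound on the multiplicity would fail. -/
lemma not_subset_hexEdge (hδ : 0 < δ) (hr : δ ≤ r) (hR : 200 * r ≤ R) {K : Set ℂ} {y z : ℂ}
    (hy : y ∈ frontier (box x r)) (hz : z ∈ frontier (box x R)) (hyK : y ∈ K) (hzK : z ∈ K)
    {v w : Site} (hvw : Adj v w) : ¬ K ⊆ hexEdge δ v w := by
  intro hsub
  have h1 := norm_le_of_sq_le hδ (sq_norm_le_of_mem_hexEdge hvw (hsub hyK))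
  have h2 := norm_le_of_sq_le hδ (sq_norm_le_of_mem_hexEdge hvw (hsub hzK))
  have h3 : ‖z - y‖ ≤ 2 * δ := by
    have := norm_sub_le (z - pos δ v) (y - pos δ v)
    rw [sub_sub_sub_cancel_right] at this
    linarith
  obtain ⟨yA, yB⟩ := le_of_mem_frontier_box hy
  have e : z - y = (z - x) - (y - x) := by ring
  rcases ge_of_mem_frontier_box hz with h | h
  · have h4 := abs_coordA_le (z - y)
    rw [e, coordA_sub, ← e] at h4
    have := abs_sub_abs_le_abs_sub (coordA (z - x)) (coordA (y - x))
    linarith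
  · have h4 := abs_coordB_le (z - y)
    rw [e, coordB_sub, ← e] at h4
    have := abs_sub_abs_le_abs_sub (coordB (z - x)) (coordB (y - x))
    linarith

/-- The sites around `o` which matter for the crossings of the annuli around `o`. -/
def window (o : Site) (M : ℕ) : Finset Site :=
  rectFin (o.1 - 48 * M) (o.1 + 48 * M) (o.2 - 48 * M) (o.2 + 48 * M)

lemma scaleCross_of_crossedBy (hδ : 0 < δ) (hr : δ ≤ r) (hR : 200 * 4 ^ N * r ≤ R) {k : ℕ}
    (h : boundaryCurves δ ω ∈ CrossedBy x r R k) (c : Bool) :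
    ScaleCross (nearSite δ x) (k / 243) (innerRadius δ r) N
      ((window (nearSite δ x) (4 ^ N * innerRadius δ r)).filter fun v => ω v = c) := by
  obtain ⟨γ, s, t, hγ, hdisj⟩ := h
  have hR' : 200 * r ≤ R := by
    have h4 : (1 : ℝ) ≤ 4 ^ N := one_le_pow₀ (by norm_num)
    nlinarith
  set K : Fin k → Set ℂ := fun i => γ i '' Set.uIcc (s i) (t i)
  have hK : ∀ i, IsCompact (K i) := fun i => isCompact_uIcc.image (γ i).continuous
  have hK' : ∀ i, IsPreconnected (K i) := fun i =>
    isPreconnected_uIcc.image _ (γ i).continuous.continuousOn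
  have hKω : ∀ i, OnInterface δ ω (K i) := by
    rintro i z ⟨a, -, rfl⟩
    obtain ⟨⟨⟨S, hS, hrange⟩, -⟩, -⟩ := hγ i
    have : γ i a ∈ ⋃ e ∈ S, hexEdge δ e.1 e.2 := hrange ▸ Set.mem_range_self a
    obtain ⟨e, he, hz⟩ := Set.mem_iUnion₂.1 this
    exact ⟨e.1, e.2, (hS e he).1, (hS e he).2, hz⟩
  have hs : ∀ i, γ i (s i) ∈ K i := fun i => Set.mem_image_of_mem _ Set.left_mem_uIcc
  have ht : ∀ i, γ i (t i) ∈ K i := fun i => Set.mem_image_of_mem _ Set.right_mem_uIcc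
  refine scaleCross_of_linked (b := 81) (by have := two_le_innerRadius hδ hr; omega) (by norm_num)
    (Finset.univ : Finset (Fin k)) (by rw [Finset.card_fin]; omega)
    (fun i => trail δ ω c (K i)) _ ?_ ?_ ?_
  · rintro i - z ⟨e, he, rfl⟩ hz
    rw [Finset.mem_filter, window, mem_rectFin]
    exact ⟨mem_rect.1 hz, he.2.1⟩
  · intro i _
    obtain ⟨u, hu, hu'⟩ := (hKω i).exists_near hδ c (hs i)
    obtain ⟨v, hv, hv'⟩ := (hKω i).exists_near hδ c (ht i)
    exact ⟨u, v, linked_trail hδ (hK i) (hK' i) (hKω i) hu hv,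
      chart_lt_of_mem_frontier hδ hr (hγ i).2.1 hu',
      exists_le_chart_of_mem_frontier hδ hr hR (hγ i).2.2.1 hv'⟩
  · intro z J _ hJ
    exact card_trail_le hδ hK hK' hKω
      (fun i v w => not_subset_hexEdge hδ hr hR' (hγ i).2.1 (hγ i).2.2.1 (hs i) (ht i)) hdisj hJ

/-! ### Exponents and the final estimate -/

/-- The factor gained on each scale. -/
def scaleFactor (k : ℕ) : ℝ := 3 * (1 - (1 / 2) ^ 46) ^ (k / 243)

lemma scaleFactor_pos (k : ℕ) : 0 < scaleFactor k := by
  have : (0 : ℝ) < 1 - (1 / 2) ^ 46 := by norm_num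
  unfold scaleFactor
  positivity

lemma tendsto_scaleFactor : Tendsto scaleFactor atTop (𝓝 0) := by
  have h1 : Tendsto (fun m : ℕ => (1 - (1 / 2 : ℝ) ^ 46) ^ m) atTop (𝓝 0) :=
    tendsto_pow_atTop_nhds_zero_of_lt_one (by norm_num) (by norm_num)
  have h2 := (h1.comp (Nat.tendsto_div_const_atTop (by norm_num : (243 : ℕ) ≠ 0))).const_mul 3
  rw [mul_zero] at h2
  exact h2

lemma interfaceLaw_crossedBy_le (hδ : 0 < δ) (hr : δ ≤ r) (hR : 200 * 4 ^ N * r ≤ R) (k : ℕ)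
    (p : unitInterval) (x : ℂ) :
    interfaceLaw δ p (CrossedBy x r R k) ≤ ENNReal.ofReal (scaleFactor k ^ N) := by
  obtain ⟨c, hc⟩ := exists_colourProb_le p
  refine (measure_mono fun ω hω => scaleCross_of_crossedBy hδ hr hR hω c).trans
    ((percolation_le_bern p c _ _).trans (ENNReal.ofReal_le_ofReal ?_))
  refine (Increasing.bern_le_unif (increasing_disjOccs _ _) (colourProb_nonneg p c) hc _).trans ?_
  exact unif_scaleCross_le _ _ (by have := two_le_innerRadius hδ hr; omega) _ _

lemma interfaceLaw_le_one (δ : ℝ) (p : unitInterval) (E : Set (Set Curve)) :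
    interfaceLaw δ p E ≤ 1 := by
  have : IsProbabilityMeasure (percolation p) := by unfold percolation; infer_instance
  exact prob_le_one

/-- The exponent for crossings by `k` disjoint curves. -/
def crossingExponent (k : ℕ) : ℝ := max 0 (-Real.log (scaleFactor k) / Real.log 4)

lemma tendsto_crossingExponent : Tendsto crossingExponent atTop atTop := by
  have h1 : Tendsto scaleFactor atTop (𝓝[>] 0) :=
    tendsto_nhdsWithin_iff.2 ⟨tendsto_scaleFactor, .of_forall scaleFactor_pos⟩
  have h2 := (tendsto_neg_atBot_atTop.comp (Real.tendsto_log_nhdsGT_zero.comp h1)).atTop_div_const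
    (Real.log_pos (by norm_num : (1 : ℝ) < 4))
  exact tendsto_atTop_mono (fun k => le_max_right _ _) h2

lemma interfaceLaw_crossedBy_le_rpow (hδ : 0 < δ) (hr : δ ≤ r) (hR : r ≤ R) (k : ℕ)
    (p : unitInterval) (x : ℂ) :
    interfaceLaw δ p (CrossedBy x r R k) ≤
      ENNReal.ofReal (800 ^ crossingExponent k * (r / R) ^ crossingExponent k) := by
  have hr0 : 0 < r := hδ.trans_le hr
  have hR0 : 0 < R := hr0.trans_le hR
  have hφ : 0 ≤ crossingExponent k := le_max_left _ _
  rw [← Real.mul_rpow (by norm_num) (by positivity)]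
  by_cases hfar : R < 800 * r
  · refine (interfaceLaw_le_one _ _ _).trans ?_
    rw [← ENNReal.ofReal_one]
    refine ENNReal.ofReal_le_ofReal (Real.one_le_rpow ?_ hφ)
    rw [← mul_div_assoc, one_le_div hR0]
    exact hfar.le
  -- For small `k` the factor per scale is at least 1 and the exponent is 0; the bound is then
  -- trivial.
  rcases le_or_gt (-Real.log (scaleFactor k) / Real.log 4) 0 with h0 | h0
  · rw [crossingExponent, max_eq_left h0, Real.rpow_zero, ENNReal.ofReal_one]
    exact interfaceLaw_le_one _ _ _
  · have hq : 1 ≤ R / (200 * r) := by rw [one_le_div (by positivity)]; linarith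
    -- `N` is the largest number of scales that fit. Its maximality gives `4 ^ (-N) < 800 * r / R`
    -- with `800 = 4 * 200`, and the exponent is chosen so that the factor per scale is `4 ^ (-φ)`.
    obtain ⟨N, hN, hN'⟩ := exists_nat_pow_near hq (by norm_num : (1 : ℝ) < 4)
    rw [le_div_iff₀ (by positivity)] at hN
    rw [div_lt_iff₀ (by positivity), pow_succ] at hN'
    refine (interfaceLaw_crossedBy_le (N := N) hδ hr (by linarith) k p x).trans
      (ENNReal.ofReal_le_ofReal ?_)
    have e : scaleFactor k = (1 / 4) ^ crossingExponent k := by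
      have h4 : Real.log 4 ≠ 0 := (Real.log_pos (by norm_num)).ne'
      rw [crossingExponent, max_eq_right h0.le, Real.rpow_def_of_pos (by norm_num), one_div,
        Real.log_inv]
      field_simp
      rw [Real.exp_log (scaleFactor_pos k)]
    rw [e, ← Real.rpow_natCast, ← Real.rpow_mul (by norm_num), mul_comm, Real.rpow_mul (by norm_num),
      Real.rpow_natCast]
    refine Real.rpow_le_rpow (by positivity) ?_ hφ
    rw [one_div, inv_pow, inv_le_iff_one_le_mul₀ (by positivity), ← mul_div_assoc, ← mul_div_right_comm,
      one_le_div hR0]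
    linarith

end Crossing

end TriPerc

end

theorem lemma2 (δ : ℕ → ℝ) (hδ_pos : ∀ j, 0 < δ j) (hδ : Tendsto δ atTop (𝓝 0))
    (p : ℕ → unitInterval) :
    ∃ (K φ : ℕ → ℝ), Tendsto φ atTop atTop ∧
      ∀ (j k : ℕ) (x : ℂ) (r R : ℝ), δ j ≤ r → r ≤ R → R ≤ 1 →
        TriPerc.interfaceLaw (δ j) (p j) (TriPerc.CrossedBy x r R k) ≤
          ENNReal.ofReal (K k * (r / R) ^ φ k) :=
  ⟨fun k => 800 ^ TriPerc.crossingExponent k, TriPerc.crossingExponent,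
    TriPerc.tendsto_crossingExponent, fun j k x _ _ hr hR _ =>
      TriPerc.interfaceLaw_crossedBy_le_rpow (hδ_pos j) hr hR k (p j) x⟩
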